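/- Theorem 4.3. Let $d,n\ge 1$ and $p\ge2$. For every $\lambda\in\mathbb R^d$ let $Z(\lambda)$ be an $\mathbb R^n$-valued random variable with Lebesgue density $f(\lambda,\cdot)$; fix $\lambda^0\in\mathbb R^d$ and $\phi\in L^\infty(\mathbb R^n,\mathbb R)$, and put $Z^0=Z(\lambda^0)$, $V(\lambda)=\mathbb E[\phi(Z(\lambda))]$ and $\beta=\nabla V(\lambda^0)$. Let $K:\mathbb R^d\to\mathbb R$ be $C^1$, supported in $[-1,1]^d$, with $\int K=1$ and of order $p$, i.e. $\int l_{\alpha_1}\cdots l_{\alpha_r}K(l)\,dl=0$ for all $0<r<p$ and all indices $\alpha_k\in\{1,\dots,d\}$, while $\int l_{j_1}\cdots l_{j_p}K(l)\,dl\neq0$ for some indices $j_1,\dots,j_p$. Assume that for every $z$ the function $f(\cdot,z)$ is $p+1$ times differentiable and that, for some set $S$ with $\mathrm{Supp}(\phi)\subset\mathrm{int}(S)$ and every integer $0\le i\le p+1$, the function $\lambda\mapsto\nabla^i_\lambda f(\lambda,z)$ is continuous at $\lambda^0$ uniformly in $z\in S$. Let $h=h_N>0$ and, for every $N$, let $(\Lambda_i,Z_i)_{1\le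 i\le N}$ be i.i.d. with density $(\lambda,z)\mapsto \ell(\lambda^0-\lambda)f(\lambda,z)$, where $\ell$ is the uniform density on $[-h,h]^d$. Put $$\hat\beta^u_N=\frac{2^d}{Nh}\sum_{i=1}^N\phi(Z_i)\,\nabla K\Big(\frac{\lambda^0-\Lambda_i}{h}\Big),\qquad \Sigma_u=2^d\,\mathbb E[\phi^2(Z^0)]\int\nabla K(l)\,\nabla K(l)'\,dl .$$ (i) If $h\to0$ and $Nh^2\to\infty$ as $N\to\infty$, then $\hat\beta^u_N$ is integrable and $\sqrt{Nh^2}\,(\hat\beta^u_N-\mathbb E[\hat\beta^u_N])\to\mathcal N(0,\Sigma_u)$ in distribution. (ii) Suppose in addition that $Nh^{2p+2}\to0$ and that either $\phi$ is Lebesgue integrable (for instance, $\phi$ has bounded support) or there are $r>0$ and a Lebesgue integrable function $g$ on $\mathbb R^n$ such that, for almost every $z$, $|\phi(z)|\,\|\nabla^{p+1}_\lambda f(\lambda,z)\|\le g(z)$ for all $|\lambda-\lambda^0|<r$. Then $V$ is differentiable at $\lambda^0$, the bias vanishes, namely $\mathbb E[\hat\beta^u_N]\to\beta$ and even $\sqrt{Nh^2}\,(\mathbb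 E[\hat\beta^u_N]-\beta)\to0$, and $\sqrt{Nh^2}\,(\hat\beta^u_N-\beta)\to\mathcal N(0,\Sigma_u)$ in distribution. In particular, the rate $\sqrt{Nh^2}$ does not depend on the dimension $d$. -/

import Mathlib

open MeasureTheory ProbabilityTheory Filter Topology

noncomputable section

/-- `g` is `k` times differentiable on the whole space: the iterated derivatives of every
order `< k` are differentiable everywhere (the `k`-th one need not be continuous). -/
def TimesDifferentiable {d : ℕ} (k : ℕ) (g : EuclideanSpace ℝ (Fin d) → ℝ) : Prop :=
  ∀ i < k, Differentiable ℝ (iteratedFDeriv ℝ i g)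

/-- The kernel `K` is of order `p`: `p` is the smallest positive integer for which some moment
`∫ l_{j_1} ⋯ l_{j_p} K(l) dl` does not vanish. -/
def IsKernelOfOrder {d : ℕ} (K : EuclideanSpace ℝ (Fin d) → ℝ) (p : ℕ) : Prop :=
  0 < p ∧
  (∀ r : ℕ, 0 < r → r < p → ∀ α : Fin r → Fin d,
    ∫ l : EuclideanSpace ℝ (Fin d), (∏ k, l (α k)) * K l = 0) ∧
  ∃ j : Fin p → Fin d, ∫ l : EuclideanSpace ℝ (Fin d), (∏ k, l (j k)) * K l ≠ 0

/-- Conditions on the kernel: `K` is `C¹`, vanishes outside the cube `[-1, 1]^d`, has integral one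
and is of order `p ≥ 2`. -/
structure KernelAssumption {d : ℕ} (K : EuclideanSpace ℝ (Fin d) → ℝ) (p : ℕ) : Prop where
  contDiff : ContDiff ℝ 1 K
  support_subset : Function.support K ⊆ {l | ∀ j, |l j| ≤ 1}
  integral_eq_one : ∫ l, K l = 1
  two_le : 2 ≤ p
  order : IsKernelOfOrder K p

/-- Regularity of the parametric density `f` at `lam0`, relative to the support of `φ`: each
`f(·, z)` is `p + 1` times differentiable and, for some set `S` whose interior contains the
support of `φ`, all the derivatives `∇^i_λ f(λ, z)`, `i ≤ p + 1`, are continuous in `λ` at `lam0`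
uniformly with respect to `z ∈ S`. -/
structure RegularityAssumption {d n : ℕ}
    (f : EuclideanSpace ℝ (Fin d) → EuclideanSpace ℝ (Fin n) → ℝ)
    (φ : EuclideanSpace ℝ (Fin n) → ℝ) (lam0 : EuclideanSpace ℝ (Fin d)) (p : ℕ) : Prop where
  timesDifferentiable : ∀ z, TimesDifferentiable (p + 1) (fun lam => f lam z)
  uniform_continuity : ∃ S : Set (EuclideanSpace ℝ (Fin n)), tsupport φ ⊆ interior S ∧
    ∀ i ≤ p + 1, TendstoUniformlyOn
      (fun lam z => iteratedFDeriv ℝ i (fun l => f l z) lam)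
      (fun z => iteratedFDeriv ℝ i (fun l => f l z) lam0) (𝓝 lam0) S

/-- Near `lam0`, the functions `z ↦ φ(z) ∇^k_λ f(λ, z)` are dominated by one Lebesgue integrable
function of `z`. -/
def LocallyDominated {d n : ℕ} (k : ℕ)
    (f : EuclideanSpace ℝ (Fin d) → EuclideanSpace ℝ (Fin n) → ℝ)
    (φ : EuclideanSpace ℝ (Fin n) → ℝ) (lam0 : EuclideanSpace ℝ (Fin d)) : Prop :=
  ∃ r > 0, ∃ g : EuclideanSpace ℝ (Fin n) → ℝ, Integrable g ∧
    ∀ᵐ z, ∀ lam ∈ Metric.ball lam0 r,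
      |φ z| * ‖iteratedFDeriv ℝ k (fun l => f l z) lam‖ ≤ g z

/-- The uniform probability density on the cube `[-ε, ε]^d`. -/
def uniformCubeDensity (d : ℕ) (ε : ℝ) (l : EuclideanSpace ℝ (Fin d)) : ℝ :=
  open Classical in if ∀ j, |l j| ≤ ε then ((2 * ε) ^ d)⁻¹ else 0

/-- The joint law on `ℝ^d × ℝ^n` with density `ℓ(lam0 - λ) f(λ, z)`: the randomized parameter has
density `ℓ(lam0 - ·)`, and given its value `λ` the observation has density `f(λ, ·)`. -/
def randomizedLaw {d n : ℕ} (ℓ : EuclideanSpace ℝ (Fin d) → ℝ)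
    (f : EuclideanSpace ℝ (Fin d) → EuclideanSpace ℝ (Fin n) → ℝ)
    (lam0 : EuclideanSpace ℝ (Fin d)) :
    Measure (EuclideanSpace ℝ (Fin d) × EuclideanSpace ℝ (Fin n)) :=
  (volume : Measure (EuclideanSpace ℝ (Fin d) × EuclideanSpace ℝ (Fin n))).withDensity
    (fun q => ENNReal.ofReal (ℓ (lam0 - q.1) * f q.1 q.2))

/-- The estimator `(2^d / (N h)) ∑ φ(Z_i) ∇K((lam0 - Λ_i) / h)` computed from the sample
`(L_i, z_i)`, `i < N`. -/
def uniformKernelEstimator {d n : ℕ} (K : EuclideanSpace ℝ (Fin d) → ℝ)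
    (φ : EuclideanSpace ℝ (Fin n) → ℝ) (lam0 : EuclideanSpace ℝ (Fin d)) (N : ℕ) (h : ℝ)
    (L : Fin N → EuclideanSpace ℝ (Fin d)) (z : Fin N → EuclideanSpace ℝ (Fin n)) :
    EuclideanSpace ℝ (Fin d) :=
  ((2 : ℝ) ^ d / (N * h)) • ∑ i, φ (z i) • gradient K (h⁻¹ • (lam0 - L i))

/-- The matrix `2^d m ∫ ∇K ∇Kᵀ`; below, `m` is the second moment `E[φ²(Z⁰)]`. -/
def asymptoticCovariance {d : ℕ} (K : EuclideanSpace ℝ (Fin d) → ℝ) (m : ℝ) :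
    Matrix (Fin d) (Fin d) ℝ :=
  Matrix.of fun j k => (2 : ℝ) ^ d * m * ∫ l, gradient K l j * gradient K l k

end

/-!
Write `m_ψ(λ) = ∫ f(λ, z) ψ(z) dz`, so that `V = m_φ`. A sample `(Λ, Z)` being uniform in `Λ` on a
cube of half-width `h`, the score `2 ^ d φ(Z) ∇K((λ⁰ - Λ) / h)` has mean
`∫ V(λ⁰ - h l) ∇K(l) dl` and uncentred second moment `2 ^ d ∫ m_{φ²}(λ⁰ - h l) ∇K(l) ∇K(l)ᵀ dl`.

* Scheffé's lemma makes `m_ψ` continuous at `λ⁰` for bounded `ψ`. Since `∫ ∇K = 0`, the covariance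
  of the score tends to `Σ_u`; the score being bounded uniformly in `h`, a central limit theorem for
  triangular arrays of uniformly bounded variables applies.
* Integrating the Taylor formula of `f(·, z)` against `φ` gives
  `V(λ⁰ + u) = Q(u) + O(‖u‖ ^ (p + 1))` with a polynomial `Q` of degree at most `p`. After an
  integration by parts, the vanishing moments of `K` reproduce `∇Q(0) = β` exactly, so the bias is
  `O(h ^ p)`, which is `o(1 / √(N h²))` when `N h ^ (2p + 2) → 0`; Slutsky's lemma then recentres
  the limit theorem at `β`.
-/

section CentralLimit

open scoped RealInnerProductSpace

theorem norm_cexp_ofReal_mul_I_sub_taylor_two_le {x : ℝ} (hx : |x| ≤ 1) :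
    ‖Complex.exp (x * Complex.I) - (1 + x * Complex.I - (x ^ 2 / 2 : ℝ))‖ ≤ |x| ^ 3 := by
  have hnorm : ‖(x * Complex.I : ℂ)‖ = |x| := by simp
  have hbound := Complex.exp_bound (hnorm.trans_le hx) (n := 3) (by norm_num)
  have hsum : ∑ m ∈ Finset.range 3, (x * Complex.I : ℂ) ^ m / (m.factorial : ℂ)
      = 1 + x * Complex.I - (x ^ 2 / 2 : ℝ) := by
    simp only [Finset.sum_range_succ, Finset.sum_range_zero, mul_pow, Complex.I_sq,
      Nat.factorial_zero, Nat.factorial_one, Nat.factorial_two]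
    push_cast
    ring
  rw [hnorm, hsum] at hbound
  refine hbound.trans (mul_le_of_le_one_right (by positivity) ?_)
  norm_num [Nat.factorial]

theorem norm_integral_cexp_sub_taylor_two_le {Ω : Type*} [MeasurableSpace Ω] {P : Measure Ω}
    [IsProbabilityMeasure P] {X : Ω → ℝ} (hX : AEMeasurable X P) (hmean : P[X] = 0) {C : ℝ}
    (hC : ∀ᵐ ω ∂P, |X ω| ≤ C) (hC_le : C ≤ 1) :
    ‖∫ ω, Complex.exp (X ω * Complex.I) ∂P - (1 - (Var[X; P] / 2 : ℝ))‖ ≤ C ^ 3 := by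
  have hX_mem : MemLp X 2 P := .of_bound hX.aestronglyMeasurable C hC
  have hX_int : Integrable (fun ω => (X ω : ℂ) * Complex.I) P :=
    (hX_mem.integrable one_le_two).ofReal.mul_const _
  have hsq_int : Integrable (fun ω => ((X ω ^ 2 / 2 : ℝ) : ℂ)) P :=
    (hX_mem.integrable_sq.div_const 2).ofReal
  have hexp_int : Integrable (fun ω => Complex.exp (X ω * Complex.I)) P :=
    .of_bound (by fun_prop) 1 (.of_forall fun ω => (Complex.norm_exp_ofReal_mul_I _).le)
  have htaylor_int : Integrable (fun ω => 1 + X ω * Complex.I) P :=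
    (integrable_const 1).add hX_int
  have htaylor : ∫ ω, (1 + X ω * Complex.I - (X ω ^ 2 / 2 : ℝ)) ∂P
      = 1 - (Var[X; P] / 2 : ℝ) := by
    rw [variance_of_integral_eq_zero hX hmean, integral_sub htaylor_int hsq_int,
      integral_add (integrable_const 1) hX_int, integral_mul_const, integral_complex_ofReal,
      integral_complex_ofReal, hmean, integral_div]
    simp
  rw [← htaylor, ← integral_sub hexp_int (by exact htaylor_int.sub hsq_int)]
  refine (norm_integral_le_of_norm_le_const (C := C ^ 3) ?_).trans (by simp)
  filter_upwards [hC] with ω hω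
  exact (norm_cexp_ofReal_mul_I_sub_taylor_two_le (hω.trans hC_le)).trans (by gcongr)

variable {E : Type*} [NormedAddCommGroup E] [InnerProductSpace ℝ E] [MeasurableSpace E]
  [BorelSpace E] [SecondCountableTopology E]

variable {Ω : Type*} [MeasurableSpace Ω] {P : Measure Ω}

theorem charFun_map_smul_sum_of_iIndepFun {ι : Type*} [Fintype ι] {Y : ι → Ω → E}
    {μ : Measure E} (hlaw : ∀ i, HasLaw (Y i) μ P) (hindep : iIndepFun Y P) (c : ℝ) (t : E) :
    charFun (P.map fun ω => c • ∑ i, Y i ω) t = charFun μ (c • t) ^ Fintype.card ι := by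
  have hY (i : ι) : AEMeasurable (Y i) P := (hlaw i).aemeasurable
  have hsum : AEMeasurable (fun ω => ∑ i, Y i ω) P := Finset.aemeasurable_fun_sum _ fun i _ => hY i
  have hmap : P.map (fun ω => c • ∑ i, Y i ω)
      = (P.map fun ω => ∑ i, Y i ω).map (fun x => c • x) :=
    (AEMeasurable.map_map_of_aemeasurable (by fun_prop) hsum).symm
  rw [hmap, charFun_map_smul, hindep.charFun_map_fun_sum_eq_prod hY]
  simp [fun i => (hlaw i).map_eq]

variable [CompleteSpace E]

theorem norm_charFun_sub_taylor_two_le {μ : Measure E} [IsProbabilityMeasure μ] {C : ℝ}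
    (hC : ∀ᵐ x ∂μ, ‖x‖ ≤ C) (hmean : ∫ x, x ∂μ = 0) {s : E} (hs : C * ‖s‖ ≤ 1) :
    ‖charFun μ s - (1 - (Var[fun x => ⟪x, s⟫; μ] / 2 : ℝ))‖ ≤ (C * ‖s‖) ^ 3 := by
  have hint : Integrable (fun x : E => x) μ := .of_bound (by fun_prop) C hC
  rw [charFun_apply]
  refine norm_integral_cexp_sub_taylor_two_le (by fun_prop) ?_ ?_ hs
  · simp_rw [real_inner_comm s, integral_inner hint, hmean, inner_zero_right]
  · filter_upwards [hC] with x hx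
    exact (abs_real_inner_le_norm x s).trans (by gcongr)

theorem tendsto_inv_sqrt_natCast : Tendsto (fun N : ℕ => (√(N : ℝ))⁻¹) atTop (𝓝 0) :=
  tendsto_inv_atTop_zero.comp (Real.tendsto_sqrt_atTop.comp tendsto_natCast_atTop_atTop)

theorem norm_natCast_mul_charFun_inv_sqrt_sub_le {μ : Measure E} [IsProbabilityMeasure μ] {C : ℝ}
    (hC : ∀ᵐ x ∂μ, ‖x‖ ≤ C) (hmean : ∫ x, x ∂μ = 0) (t : E) {N : ℕ} (hN : 0 < N)
    (hNt : C * ‖t‖ * (√(N : ℝ))⁻¹ ≤ 1) :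
    ‖N * (charFun μ ((√(N : ℝ))⁻¹ • t) - 1) - (-Var[fun x => ⟪x, t⟫; μ] / 2 : ℝ)‖
      ≤ (C * ‖t‖) ^ 3 * (√(N : ℝ))⁻¹ := by
  have hN0 : (0 : ℝ) < N := by exact_mod_cast hN
  have hsq : (√(N : ℝ))⁻¹ ^ 2 * N = 1 := by
    rw [inv_pow, Real.sq_sqrt hN0.le, inv_mul_cancel₀ hN0.ne']
  have hnorm : C * ‖(√(N : ℝ))⁻¹ • t‖ = C * ‖t‖ * (√(N : ℝ))⁻¹ := by
    rw [norm_smul, Real.norm_of_nonneg (by positivity)]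
    ring
  have hvar : N * Var[fun x => ⟪x, (√(N : ℝ))⁻¹ • t⟫; μ] = Var[fun x => ⟪x, t⟫; μ] := by
    simp_rw [inner_smul_right]
    rw [variance_const_mul]
    linear_combination Var[fun x => ⟪x, t⟫; μ] * hsq
  have hbound := norm_charFun_sub_taylor_two_le hC hmean (s := (√(N : ℝ))⁻¹ • t)
    (hnorm.trans_le hNt)
  calc _ = ‖(N : ℂ) * (charFun μ ((√(N : ℝ))⁻¹ • t)
          - (1 - (Var[fun x => ⟪x, (√(N : ℝ))⁻¹ • t⟫; μ] / 2 : ℝ)))‖ := by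
        rw [← hvar]
        push_cast
        ring_nf
    _ ≤ N * (C * ‖t‖ * (√(N : ℝ))⁻¹) ^ 3 := by
        rw [norm_mul, Complex.norm_natCast, ← hnorm]
        gcongr
    _ = (C * ‖t‖) ^ 3 * (√(N : ℝ))⁻¹ := by
        linear_combination (C * ‖t‖) ^ 3 * (√(N : ℝ))⁻¹ * hsq

theorem tendsto_charFun_inv_sqrt_smul_pow {μ : ℕ → Measure E} [∀ N, IsProbabilityMeasure (μ N)]
    {C : ℝ} (hC : ∀ N, ∀ᵐ x ∂μ N, ‖x‖ ≤ C) (hmean : ∀ N, ∫ x, x ∂μ N = 0)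
    {t : E} {q : ℝ} (hq : Tendsto (fun N => Var[fun x => ⟪x, t⟫; μ N]) atTop (𝓝 q)) :
    Tendsto (fun N : ℕ => charFun (μ N) ((√(N : ℝ))⁻¹ • t) ^ N) atTop
      (𝓝 (Complex.exp (-q / 2 : ℝ))) := by
  have hlim (a : ℝ) : Tendsto (fun N : ℕ => a * (√(N : ℝ))⁻¹) atTop (𝓝 0) := by
    simpa using tendsto_inv_sqrt_natCast.const_mul a
  have hvar : Tendsto (fun N => ((-Var[fun x => ⟪x, t⟫; μ N] / 2 : ℝ) : ℂ)) atTop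
      (𝓝 (-q / 2 : ℝ)) :=
    (Complex.continuous_ofReal.tendsto _).comp (hq.neg.div_const 2)
  have hdiff : Tendsto (fun N : ℕ => (N : ℂ) * (charFun (μ N) ((√(N : ℝ))⁻¹ • t) - 1)
      - (-Var[fun x => ⟪x, t⟫; μ N] / 2 : ℝ)) atTop (𝓝 0) := by
    refine squeeze_zero_norm' ?_ (hlim ((C * ‖t‖) ^ 3))
    filter_upwards [(hlim (C * ‖t‖)).eventually (ge_mem_nhds zero_lt_one),
      eventually_gt_atTop 0] with N hNt hN
    exact norm_natCast_mul_charFun_inv_sqrt_sub_le (hC N) (hmean N) t hN hNt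
  have hlog : Tendsto (fun N : ℕ => (N : ℂ) * (charFun (μ N) ((√(N : ℝ))⁻¹ • t) - 1)) atTop
      (𝓝 (-q / 2 : ℝ)) := by
    simpa using hdiff.add hvar
  simpa using Complex.tendsto_one_add_pow_exp_of_tendsto hlog

variable [IsProbabilityMeasure P] {κ : Type*} [Fintype κ] [DecidableEq κ]

theorem tendstoInDistribution_inv_sqrt_smul_sum_of_integral_eq_zero
    {μ : ℕ → Measure (EuclideanSpace ℝ κ)} [∀ N, IsProbabilityMeasure (μ N)]
    {Y : (N : ℕ) → Fin N → Ω → EuclideanSpace ℝ κ}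
    (hlaw : ∀ N i, HasLaw (Y N i) (μ N) P) (hindep : ∀ N, iIndepFun (Y N) P)
    {C : ℝ} (hC : ∀ N, ∀ᵐ x ∂μ N, ‖x‖ ≤ C) (hmean : ∀ N, ∫ x, x ∂μ N = 0)
    {S : Matrix κ κ ℝ} (hS : S.PosSemidef)
    (hvar : ∀ t : EuclideanSpace ℝ κ, Tendsto (fun N => Var[fun x => ⟪x, t⟫; μ N]) atTop
      (𝓝 (t.ofLp ⬝ᵥ S.mulVec t.ofLp))) :
    TendstoInDistribution (fun (N : ℕ) ω => (√(N : ℝ))⁻¹ • ∑ i, Y N i ω) atTop id (fun _ => P)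
      (multivariateGaussian 0 S) where
  forall_aemeasurable N :=
    (Finset.aemeasurable_fun_sum _ fun i _ => (hlaw N i).aemeasurable).fun_const_smul _
  aemeasurable_limit := aemeasurable_id
  tendsto := by
    refine ProbabilityMeasure.tendsto_iff_tendsto_charFun.2 fun t => ?_
    simp only [ProbabilityMeasure.coe_mk, Measure.map_id, charFun_multivariateGaussian hS,
      charFun_map_smul_sum_of_iIndepFun (hlaw _) (hindep _), Fintype.card_fin]
    convert! tendsto_charFun_inv_sqrt_smul_pow hC hmean (hvar t) using 2
    simp [neg_div]

theorem tendstoInDistribution_inv_sqrt_smul_sum_sub_integral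
    {μ : ℕ → Measure (EuclideanSpace ℝ κ)} [∀ N, IsProbabilityMeasure (μ N)]
    {Y : (N : ℕ) → Fin N → Ω → EuclideanSpace ℝ κ}
    (hlaw : ∀ N i, HasLaw (Y N i) (μ N) P) (hindep : ∀ N, iIndepFun (Y N) P)
    {C : ℝ} (hC : ∀ N, ∀ᵐ x ∂μ N, ‖x‖ ≤ C) {S : Matrix κ κ ℝ} (hS : S.PosSemidef)
    (hvar : ∀ t : EuclideanSpace ℝ κ, Tendsto (fun N => Var[fun x => ⟪x, t⟫; μ N]) atTop
      (𝓝 (t.ofLp ⬝ᵥ S.mulVec t.ofLp))) :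
    TendstoInDistribution (fun (N : ℕ) ω => (√(N : ℝ))⁻¹ • ∑ i, (Y N i ω - ∫ x, x ∂μ N)) atTop
      id (fun _ => P) (multivariateGaussian 0 S) := by
  set m : ℕ → EuclideanSpace ℝ κ := fun N => ∫ x, x ∂μ N with hm
  have hint (N : ℕ) : Integrable (fun x : EuclideanSpace ℝ κ => x) (μ N) :=
    .of_bound (by fun_prop) C (hC N)
  have hsub (N : ℕ) : HasLaw (fun x => x - m N) ((μ N).map (fun x => x - m N)) (μ N) :=
    ⟨by fun_prop, rfl⟩
  have (N : ℕ) : IsProbabilityMeasure ((μ N).map (fun x => x - m N)) :=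
    Measure.isProbabilityMeasure_map (by fun_prop)
  refine tendstoInDistribution_inv_sqrt_smul_sum_of_integral_eq_zero (C := C + C)
    (fun N i => (hsub N).fun_comp (hlaw N i))
    (fun N => (hindep N).comp (fun _ x => x - m N) fun _ => by fun_prop) ?_ ?_ hS fun t => ?_
  · intro N
    refine (ae_map_iff (by fun_prop) (measurableSet_le (by fun_prop) (by fun_prop))).2 ?_
    have hmN : ‖m N‖ ≤ C := (norm_integral_le_of_norm_le_const (hC N)).trans (by simp)
    filter_upwards [hC N] with x hx
    exact (norm_sub_le _ _).trans (add_le_add hx hmN)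
  · intro N
    rw [integral_map (by fun_prop) (by fun_prop), integral_sub (hint N) (integrable_const _)]
    simp [hm]
  · refine (hvar t).congr fun N => ?_
    rw [variance_map (by fun_prop) (by fun_prop)]
    simp only [Function.comp_def, inner_sub_left]
    exact (variance_sub_const (by fun_prop) _).symm

theorem tendstoInDistribution_inv_sqrt_smul_sum_comp_sub_integral {α : Type*} [MeasurableSpace α]
    {μ : ℕ → Measure α} [∀ N, IsProbabilityMeasure (μ N)] {X : (N : ℕ) → Fin N → Ω → α}
    (hlaw : ∀ N i, HasLaw (X N i) (μ N) P) (hindep : ∀ N, iIndepFun (X N) P)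
    {g : ℕ → α → EuclideanSpace ℝ κ} (hg : ∀ N, AEMeasurable (g N) (μ N))
    {C : ℝ} (hC : ∀ N, ∀ᵐ x ∂μ N, ‖g N x‖ ≤ C) {S : Matrix κ κ ℝ} (hS : S.PosSemidef)
    (hvar : ∀ t : EuclideanSpace ℝ κ, Tendsto (fun N => Var[fun x => ⟪g N x, t⟫; μ N]) atTop
      (𝓝 (t.ofLp ⬝ᵥ S.mulVec t.ofLp))) :
    TendstoInDistribution
      (fun (N : ℕ) ω => (√(N : ℝ))⁻¹ • ∑ i, (g N (X N i ω) - ∫ x, g N x ∂μ N)) atTop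
      id (fun _ => P) (multivariateGaussian 0 S) := by
  have (N : ℕ) := Measure.isProbabilityMeasure_map (hg N)
  have hg' (N : ℕ) (i : Fin N) : AEMeasurable (g N) (P.map (X N i)) :=
    (hlaw N i).map_eq ▸ hg N
  have hclt := tendstoInDistribution_inv_sqrt_smul_sum_sub_integral
    (μ := fun N => (μ N).map (g N)) (Y := fun N i ω => g N (X N i ω)) (P := P) (C := C)
    (fun N i => HasLaw.fun_comp ⟨hg N, rfl⟩ (hlaw N i))
    (fun N => (hindep N).comp₀ (fun _ => g N) (fun i => (hlaw N i).aemeasurable) (hg' N))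
    (fun N => (ae_map_iff (hg N) (measurableSet_le (by fun_prop) (by fun_prop))).2 (hC N)) hS
    fun t => (hvar t).congr fun N => (variance_map (by fun_prop) (hg N)).symm
  simpa only [fun N => integral_map (hg N) (f := fun x => x) (by fun_prop)] using hclt

end CentralLimit

section ProbabilityDensity

variable {α : Type*} [MeasurableSpace α] {μ : Measure α} {g : α → ℝ}

/-- `g` is a probability density with respect to `μ`. -/
structure IsProbDensity (μ : Measure α) (g : α → ℝ) : Prop where
  measurable : Measurable g
  nonneg : ∀ x, 0 ≤ g x
  lintegral_eq_one : ∫⁻ x, ENNReal.ofReal (g x) ∂μ = 1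

/-- The measure with real-valued density `g` with respect to `μ`; the negative part of `g` is
discarded. -/
noncomputable def densityLaw (μ : Measure α) (g : α → ℝ) : Measure α :=
  μ.withDensity fun x => ENNReal.ofReal (g x)

theorem densityLaw_absolutelyContinuous (μ : Measure α) (g : α → ℝ) : densityLaw μ g ≪ μ :=
  withDensity_absolutelyContinuous _ _

theorem densityLaw_univ (μ : Measure α) (g : α → ℝ) :
    densityLaw μ g Set.univ = ∫⁻ x, ENNReal.ofReal (g x) ∂μ := by
  rw [densityLaw, withDensity_apply _ MeasurableSet.univ, setLIntegral_univ]

namespace IsProbDensity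

theorem isProbabilityMeasure_densityLaw (hg : IsProbDensity μ g) :
    IsProbabilityMeasure (densityLaw μ g) :=
  ⟨(densityLaw_univ μ g).trans hg.lintegral_eq_one⟩

theorem of_hasLaw {Ω : Type*} [MeasurableSpace Ω] {P : Measure Ω} [IsProbabilityMeasure P]
    {X : Ω → α} (hg_meas : Measurable g) (hg_nonneg : ∀ x, 0 ≤ g x)
    (hX : HasLaw X (densityLaw μ g) P) : IsProbDensity μ g where
  measurable := hg_meas
  nonneg := hg_nonneg
  lintegral_eq_one := by
    rw [← densityLaw_univ, ← hX.map_eq]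
    exact (Measure.isProbabilityMeasure_map hX.aemeasurable).measure_univ

theorem integrable (hg : IsProbDensity μ g) : Integrable g μ := by
  refine ⟨hg.measurable.aestronglyMeasurable, ?_⟩
  rw [hasFiniteIntegral_iff_ofReal (ae_of_all _ hg.nonneg), hg.lintegral_eq_one]
  exact ENNReal.one_lt_top

theorem integral_eq_one (hg : IsProbDensity μ g) : ∫ x, g x ∂μ = 1 := by
  rw [integral_eq_lintegral_of_nonneg_ae (ae_of_all _ hg.nonneg)
    hg.measurable.aestronglyMeasurable, hg.lintegral_eq_one, ENNReal.toReal_one]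

theorem comp_measurePreserving {β : Type*} [MeasurableSpace β] {μ' : Measure β} {T : β → α}
    (hg : IsProbDensity μ g) (hT : MeasurePreserving T μ' μ) : IsProbDensity μ' (g ∘ T) where
  measurable := hg.measurable.comp hT.measurable
  nonneg x := hg.nonneg (T x)
  lintegral_eq_one := (hT.lintegral_comp hg.measurable.ennreal_ofReal).trans hg.lintegral_eq_one

variable {F : Type*} [NormedAddCommGroup F] [NormedSpace ℝ F]

theorem integral_densityLaw (hg : IsProbDensity μ g) (G : α → F) :
    ∫ x, G x ∂(densityLaw μ g) = ∫ x, g x • G x ∂μ := by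
  rw [densityLaw, integral_withDensity_eq_integral_toReal_smul hg.measurable.ennreal_ofReal
    (ae_of_all _ fun _ => ENNReal.ofReal_lt_top)]
  simp only [ENNReal.toReal_ofReal (hg.nonneg _)]

theorem integrable_densityLaw_iff (hg : IsProbDensity μ g) {G : α → F} :
    Integrable G (densityLaw μ g) ↔ Integrable (fun x => g x • G x) μ := by
  rw [densityLaw, integrable_withDensity_iff_integrable_smul' hg.measurable.ennreal_ofReal
    (ae_of_all _ fun _ => ENNReal.ofReal_lt_top)]
  simp only [ENNReal.toReal_ofReal (hg.nonneg _)]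

end IsProbDensity

end ProbabilityDensity

section DensityFamily

variable {Θ 𝓩 : Type*} [MeasurableSpace Θ] [MeasurableSpace 𝓩] {ν : Measure 𝓩} {f : Θ → 𝓩 → ℝ}
  {ψ : 𝓩 → ℝ} {B : ℝ}

/-- A jointly measurable family of probability densities with respect to `ν`. -/
structure IsDensityFamily (ν : Measure 𝓩) (f : Θ → 𝓩 → ℝ) : Prop where
  measurable_uncurry : Measurable (Function.uncurry f)
  isProbDensity : ∀ θ, IsProbDensity ν (f θ)

/-- The mean of `ψ` under the density `f θ`. -/
noncomputable def densityMean (ν : Measure 𝓩) (f : Θ → 𝓩 → ℝ) (ψ : 𝓩 → ℝ) (θ : Θ) : ℝ :=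
  ∫ z, f θ z * ψ z ∂ν

namespace IsDensityFamily

theorem integral_comp_eq_densityMean {Ω : Type*} [MeasurableSpace Ω] {P : Measure Ω}
    (hf : IsDensityFamily ν f) {θ : Θ} {X : Ω → 𝓩} (hX : HasLaw X (densityLaw ν (f θ)) P)
    (hψ : AEStronglyMeasurable ψ ν) : ∫ ω, ψ (X ω) ∂P = densityMean ν f ψ θ :=
  (hX.integral_comp (hψ.mono_ac (densityLaw_absolutelyContinuous _ _))).trans
    ((hf.isProbDensity θ).integral_densityLaw ψ)

theorem integrable_mul (hf : IsDensityFamily ν f) (hψ : AEStronglyMeasurable ψ ν)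
    (hB : ∀ᵐ z ∂ν, |ψ z| ≤ B) (θ : Θ) : Integrable (fun z => f θ z * ψ z) ν :=
  (hf.isProbDensity θ).integrable.mul_bdd hψ hB

theorem abs_densityMean_le (hf : IsDensityFamily ν f) (hB : ∀ᵐ z ∂ν, |ψ z| ≤ B) (θ : Θ) :
    |densityMean ν f ψ θ| ≤ B := by
  have := (hf.isProbDensity θ).isProbabilityMeasure_densityLaw
  have hmean : densityMean ν f ψ θ = ∫ z, ψ z ∂(densityLaw ν (f θ)) :=
    ((hf.isProbDensity θ).integral_densityLaw ψ).symm
  have hB' : ∀ᵐ z ∂(densityLaw ν (f θ)), ‖ψ z‖ ≤ B :=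
    (densityLaw_absolutelyContinuous _ _).ae_le hB
  rw [hmean]
  exact (norm_integral_le_of_norm_le_const hB').trans (by simp)

variable [SFinite ν]

theorem aestronglyMeasurable_densityMean (hf : IsDensityFamily ν f)
    (hψ : AEStronglyMeasurable ψ ν) (μ : Measure Θ) :
    AEStronglyMeasurable (densityMean ν f ψ) μ :=
  (hf.measurable_uncurry.aestronglyMeasurable.mul
    (hψ.comp_quasiMeasurePreserving Measure.quasiMeasurePreserving_snd)).integral_prod_right'

variable {μ : Measure Θ} {g : Θ → ℝ}

theorem isProbDensity_prod (hf : IsDensityFamily ν f) (hg : IsProbDensity μ g) :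
    IsProbDensity (μ.prod ν) fun q => g q.1 * f q.1 q.2 where
  measurable := (hg.measurable.comp measurable_fst).mul hf.measurable_uncurry
  nonneg q := mul_nonneg (hg.nonneg q.1) ((hf.isProbDensity q.1).nonneg q.2)
  lintegral_eq_one := by
    rw [lintegral_prod (fun q => ENNReal.ofReal (g q.1 * f q.1 q.2))
      ((hg.measurable.comp measurable_fst).mul hf.measurable_uncurry).ennreal_ofReal.aemeasurable]
    have hinner (θ : Θ) : ∫⁻ z, ENNReal.ofReal (g θ * f θ z) ∂ν = ENNReal.ofReal (g θ) := by
      simp only [ENNReal.ofReal_mul (hg.nonneg θ)]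
      rw [lintegral_const_mul _ (hf.isProbDensity θ).measurable.ennreal_ofReal,
        (hf.isProbDensity θ).lintegral_eq_one, mul_one]
    simp only [hinner, hg.lintegral_eq_one]

variable {F : Type*} [NormedAddCommGroup F] [NormedSpace ℝ F] {G : Θ → F} {A : ℝ}

theorem integrable_smul_prod (hf : IsDensityFamily ν f) (hg : IsProbDensity μ g)
    (hψ : AEStronglyMeasurable ψ ν) (hB : ∀ᵐ z ∂ν, |ψ z| ≤ B) (hG : AEStronglyMeasurable G μ)
    (hA : ∀ θ, ‖G θ‖ ≤ A) :
    Integrable (fun q => ψ q.2 • G q.1) (densityLaw (μ.prod ν) fun q => g q.1 * f q.1 q.2) := by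
  have := (hf.isProbDensity_prod hg).isProbabilityMeasure_densityLaw
  have hac := densityLaw_absolutelyContinuous (μ.prod ν) fun q => g q.1 * f q.1 q.2
  refine .of_bound (C := B * A) (((hψ.comp_quasiMeasurePreserving
    Measure.quasiMeasurePreserving_snd).smul (hG.comp_quasiMeasurePreserving
    Measure.quasiMeasurePreserving_fst)).mono_ac hac) ?_
  filter_upwards [hac.ae_le (Measure.quasiMeasurePreserving_snd.ae hB)] with q hq
  rw [norm_smul]
  exact mul_le_mul hq (hA q.1) (norm_nonneg _) ((abs_nonneg _).trans hq)

theorem integral_smul_prod [CompleteSpace F] [SFinite μ] (hf : IsDensityFamily ν f)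
    (hg : IsProbDensity μ g) (hψ : AEStronglyMeasurable ψ ν) (hB : ∀ᵐ z ∂ν, |ψ z| ≤ B)
    (hG : AEStronglyMeasurable G μ) (hA : ∀ θ, ‖G θ‖ ≤ A) :
    ∫ q, ψ q.2 • G q.1 ∂(densityLaw (μ.prod ν) fun q => g q.1 * f q.1 q.2)
      = ∫ θ, g θ • densityMean ν f ψ θ • G θ ∂μ := by
  have hint := hf.integrable_smul_prod hg hψ hB hG hA
  rw [(hf.isProbDensity_prod hg).integrable_densityLaw_iff] at hint
  rw [(hf.isProbDensity_prod hg).integral_densityLaw, integral_prod _ hint]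
  congr 1 with θ
  rw [densityMean, ← integral_smul_const, ← integral_smul]
  congr 1 with z
  simp only [smul_smul, mul_assoc]

end IsDensityFamily

end DensityFamily

section UniformCube

/-- The closed cube `[-ε, ε]^d`. -/
def closedCube (d : ℕ) (ε : ℝ) : Set (EuclideanSpace ℝ (Fin d)) := {l | ∀ j, |l j| ≤ ε}

theorem closedCube_eq_preimage (d : ℕ) (ε : ℝ) :
    closedCube d ε = (WithLp.ofLp : EuclideanSpace ℝ (Fin d) → Fin d → ℝ) ⁻¹'
      Set.Icc (fun _ => -ε) (fun _ => ε) := by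
  ext l
  simp only [closedCube, Set.mem_ofPred_eq, Set.mem_preimage, Set.mem_Icc, Pi.le_def, abs_le,
    forall_and]

theorem isCompact_closedCube (d : ℕ) (ε : ℝ) : IsCompact (closedCube d ε) := by
  rw [closedCube_eq_preimage]
  exact (EuclideanSpace.equiv (Fin d) ℝ).toHomeomorph.isCompact_preimage.2 isCompact_Icc

theorem hasCompactSupport_of_support_subset_closedCube {d : ℕ} {ε : ℝ} {F : Type*} [Zero F]
    {k : EuclideanSpace ℝ (Fin d) → F} (hk_supp : Function.support k ⊆ closedCube d ε) :
    HasCompactSupport k :=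
  .of_support_subset_isCompact (isCompact_closedCube d ε) hk_supp

theorem smul_mem_closedCube_iff {d : ℕ} {h ε : ℝ} (hh : 0 < h) {l : EuclideanSpace ℝ (Fin d)} :
    h • l ∈ closedCube d (h * ε) ↔ l ∈ closedCube d ε := by
  simp only [closedCube, Set.mem_ofPred_eq, PiLp.smul_apply, smul_eq_mul, abs_mul, abs_of_pos hh,
    mul_le_mul_iff_right₀ hh]

theorem volume_closedCube (d : ℕ) {ε : ℝ} (hε : 0 < ε) :
    volume (closedCube d ε) = ENNReal.ofReal ((2 * ε) ^ d) := by
  rw [closedCube_eq_preimage]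
  refine ((EuclideanSpace.volume_preserving_symm_measurableEquiv_toLp
    (Fin d)).measure_preimage measurableSet_Icc.nullMeasurableSet).trans ?_
  simp only [Real.volume_Icc_pi, sub_neg_eq_add, ← two_mul, Finset.prod_const, Finset.card_univ,
    Fintype.card_fin, ENNReal.ofReal_pow (by positivity : (0 : ℝ) ≤ 2 * ε)]

theorem uniformCubeDensity_eq_indicator (d : ℕ) (ε : ℝ) :
    uniformCubeDensity d ε = (closedCube d ε).indicator fun _ => ((2 * ε) ^ d)⁻¹ := by
  ext l
  simp only [uniformCubeDensity, Set.indicator, closedCube, Set.mem_ofPred_eq]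
  congr

theorem isProbDensity_uniformCubeDensity (d : ℕ) {ε : ℝ} (hε : 0 < ε) :
    IsProbDensity volume (uniformCubeDensity d ε) := by
  have hcube : MeasurableSet (closedCube d ε) := (isCompact_closedCube d ε).measurableSet
  rw [uniformCubeDensity_eq_indicator]
  refine ⟨measurable_const.indicator hcube, Set.indicator_nonneg fun _ _ => by positivity, ?_⟩
  have hind : (fun l => ENNReal.ofReal ((closedCube d ε).indicator (fun _ => ((2 * ε) ^ d)⁻¹) l))
      = (closedCube d ε).indicator fun _ => ENNReal.ofReal ((2 * ε) ^ d)⁻¹ :=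
    (Set.indicator_comp_of_zero ENNReal.ofReal_zero).symm
  rw [hind, lintegral_indicator_const hcube, volume_closedCube d hε,
    ← ENNReal.ofReal_mul (by positivity), inv_mul_cancel₀ (by positivity), ENNReal.ofReal_one]

theorem uniformCubeDensity_smul (d : ℕ) {h : ℝ} (hh : 0 < h) (l : EuclideanSpace ℝ (Fin d)) :
    uniformCubeDensity d h (h • l) = (h ^ d)⁻¹ * uniformCubeDensity d 1 l := by
  have hmem : h • l ∈ closedCube d h ↔ l ∈ closedCube d 1 := by
    simpa using smul_mem_closedCube_iff (ε := 1) hh (l := l)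
  rw [uniformCubeDensity_eq_indicator, uniformCubeDensity_eq_indicator]
  by_cases hl : l ∈ closedCube d 1
  · rw [Set.indicator_of_mem hl, Set.indicator_of_mem (hmem.2 hl), mul_one, mul_pow, mul_inv,
      mul_comm]
  · rw [Set.indicator_of_notMem hl, Set.indicator_of_notMem (mt hmem.1 hl), mul_zero]

variable {d : ℕ} {F : Type*} [NormedAddCommGroup F] [NormedSpace ℝ F]

theorem integral_uniformCubeDensity_smul {h : ℝ} (hh : 0 < h) (G : EuclideanSpace ℝ (Fin d) → F) :
    ∫ u, uniformCubeDensity d h u • G u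
      = ((2 : ℝ) ^ d)⁻¹ • ∫ l in closedCube d 1, G (h • l) := by
  have hscale := Measure.integral_comp_smul_of_nonneg volume
    (fun u => uniformCubeDensity d h u • G u) h (hR := hh.le)
  simp only [uniformCubeDensity_smul d hh, finrank_euclideanSpace_fin, mul_smul] at hscale
  rw [integral_smul] at hscale
  rw [← smul_right_injective F (inv_ne_zero (pow_pos hh d).ne') hscale,
    ← integral_indicator (isCompact_closedCube d 1).measurableSet, ← integral_smul]
  congr 1 with l
  simp only [uniformCubeDensity_eq_indicator, mul_one, Set.indicator]
  split_ifs <;> simp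

end UniformCube

section LocalizedLaw

variable {d : ℕ} {𝓩 : Type*} [MeasurableSpace 𝓩] {ν : Measure 𝓩}
  {f : EuclideanSpace ℝ (Fin d) → 𝓩 → ℝ}

/-- The law `randomizedLaw (uniformCubeDensity d h) f lam0` for an arbitrary sample space: the
parameter is uniform on the cube of half-width `h` centred at `lam0`. -/
noncomputable def localizedLaw (ν : Measure 𝓩) (f : EuclideanSpace ℝ (Fin d) → 𝓩 → ℝ)
    (lam0 : EuclideanSpace ℝ (Fin d)) (h : ℝ) : Measure (EuclideanSpace ℝ (Fin d) × 𝓩) :=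
  densityLaw (volume.prod ν) fun q => uniformCubeDensity d h (lam0 - q.1) * f q.1 q.2

theorem isProbDensity_uniformCubeDensity_sub (lam0 : EuclideanSpace ℝ (Fin d)) {h : ℝ}
    (hh : 0 < h) : IsProbDensity volume fun lam => uniformCubeDensity d h (lam0 - lam) :=
  (isProbDensity_uniformCubeDensity d hh).comp_measurePreserving
    (Measure.measurePreserving_sub_left volume lam0)

namespace IsDensityFamily

variable [SFinite ν]

theorem isProbabilityMeasure_localizedLaw (hf : IsDensityFamily ν f)
    (lam0 : EuclideanSpace ℝ (Fin d)) {h : ℝ} (hh : 0 < h) :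
    IsProbabilityMeasure (localizedLaw ν f lam0 h) :=
  (hf.isProbDensity_prod
    (isProbDensity_uniformCubeDensity_sub lam0 hh)).isProbabilityMeasure_densityLaw

theorem integral_localizedLaw (hf : IsDensityFamily ν f) (lam0 : EuclideanSpace ℝ (Fin d))
    {h : ℝ} (hh : 0 < h) {ψ : 𝓩 → ℝ} (hψ : AEStronglyMeasurable ψ ν) {B : ℝ}
    (hB : ∀ᵐ z ∂ν, |ψ z| ≤ B) {F : Type*} [NormedAddCommGroup F] [NormedSpace ℝ F]
    [CompleteSpace F] {k : EuclideanSpace ℝ (Fin d) → F} (hk : Continuous k)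
    (hk_supp : Function.support k ⊆ closedCube d 1) :
    ∫ q, ψ q.2 • k (h⁻¹ • (lam0 - q.1)) ∂(localizedLaw ν f lam0 h)
      = ((2 : ℝ) ^ d)⁻¹ • ∫ l, densityMean ν f ψ (lam0 - h • l) • k l := by
  obtain ⟨A, hA⟩ :=
    (hasCompactSupport_of_support_subset_closedCube hk_supp).exists_bound_of_continuous hk
  have hsupp : Function.support (fun l => densityMean ν f ψ (lam0 - h • l) • k l)
      ⊆ closedCube d 1 := (Function.support_smul_subset_right _ _).trans hk_supp
  have hcentre := integral_sub_left_eq_self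
    (fun u => uniformCubeDensity d h u • densityMean ν f ψ (lam0 - u) • k (h⁻¹ • u)) volume lam0
  simp only [sub_sub_cancel] at hcentre
  rw [localizedLaw, hf.integral_smul_prod (G := fun lam => k (h⁻¹ • (lam0 - lam)))
    (isProbDensity_uniformCubeDensity_sub lam0 hh) hψ hB (by fun_prop) (fun _ => hA _), hcentre,
    integral_uniformCubeDensity_smul hh]
  simp only [inv_smul_smul₀ hh.ne', setIntegral_eq_integral_of_forall_compl_eq_zero
    fun _ hl => Function.notMem_support.1 fun h => hl (hsupp h)]

end IsDensityFamily

end LocalizedLaw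

section Scheffe

variable {α : Type*} [MeasurableSpace α] {μ : Measure α}

theorem IsProbDensity.integral_abs_sub {g₁ g₂ : α → ℝ} (h₁ : IsProbDensity μ g₁)
    (h₂ : IsProbDensity μ g₂) :
    ∫ x, |g₁ x - g₂ x| ∂μ = 2 * ∫ x, max (g₁ x - g₂ x) 0 ∂μ := by
  have hint : Integrable (fun x => g₁ x - g₂ x) μ := h₁.integrable.sub h₂.integrable
  have habs (x : α) : |g₁ x - g₂ x| = 2 * max (g₁ x - g₂ x) 0 - (g₁ x - g₂ x) := by
    rcases le_total 0 (g₁ x - g₂ x) with h | h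
    · rw [abs_of_nonneg h, max_eq_left h, two_mul, add_sub_cancel_right]
    · rw [abs_of_nonpos h, max_eq_right h, mul_zero, zero_sub]
  simp only [habs]
  rw [integral_sub (hint.pos_part.const_mul 2) hint, integral_const_mul,
    integral_sub h₁.integrable h₂.integrable, h₁.integral_eq_one, h₂.integral_eq_one, sub_self,
    sub_zero]

theorem IsProbDensity.tendsto_integral_abs_sub {ι : Type*} {L : Filter ι} [L.IsCountablyGenerated]
    {g : ι → α → ℝ} {g₀ : α → ℝ} (hg : ∀ i, IsProbDensity μ (g i)) (hg₀ : IsProbDensity μ g₀)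
    (hlim : ∀ᵐ x ∂μ, Tendsto (fun i => g i x) L (𝓝 (g₀ x))) :
    Tendsto (fun i => ∫ x, |g₀ x - g i x| ∂μ) L (𝓝 0) := by
  -- Scheffé: the positive parts `(g₀ - g i)⁺` are dominated by `g₀`.
  have hpos : Tendsto (fun i => ∫ x, max (g₀ x - g i x) 0 ∂μ) L (𝓝 (∫ _, (0 : ℝ) ∂μ)) := by
    refine tendsto_integral_filter_of_dominated_convergence g₀ (.of_forall fun i =>
      ((hg₀.measurable.sub (hg i).measurable).max measurable_const).aestronglyMeasurable)
      (.of_forall fun i => ae_of_all _ fun x => ?_) hg₀.integrable ?_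
    · rw [Real.norm_of_nonneg (le_max_right _ _)]
      exact max_le (sub_le_self _ ((hg i).nonneg x)) (hg₀.nonneg x)
    · filter_upwards [hlim] with x hx
      simpa using (hx.const_sub (g₀ x)).max (tendsto_const_nhds (x := (0 : ℝ)))
  simpa [hg₀.integral_abs_sub (hg _)] using hpos.const_mul 2

theorem IsDensityFamily.continuousAt_densityMean {Θ : Type*} [MeasurableSpace Θ]
    [TopologicalSpace Θ] [FirstCountableTopology Θ] {f : Θ → α → ℝ} (hf : IsDensityFamily μ f)
    {θ₀ : Θ} (hcont : ∀ᵐ x ∂μ, ContinuousAt (fun θ => f θ x) θ₀) {ψ : α → ℝ}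
    (hψ : AEStronglyMeasurable ψ μ) {B : ℝ} (hB : ∀ᵐ x ∂μ, |ψ x| ≤ B) :
    ContinuousAt (densityMean μ f ψ) θ₀ := by
  have hf₀ := hf.isProbDensity θ₀
  have hscheffe : Tendsto (fun θ => (∫ x, |f θ₀ x - f θ x| ∂μ) * B) (𝓝 θ₀) (𝓝 0) := by
    simpa using (IsProbDensity.tendsto_integral_abs_sub hf.isProbDensity hf₀ hcont).mul_const B
  refine tendsto_iff_norm_sub_tendsto_zero.2 (squeeze_zero (fun _ => norm_nonneg _)
    (fun θ => ?_) hscheffe)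
  rw [densityMean, densityMean,
    ← integral_sub (hf.integrable_mul hψ hB θ) (hf.integrable_mul hψ hB θ₀), ← integral_mul_const]
  refine norm_integral_le_of_norm_le
    ((hf₀.integrable.sub (hf.isProbDensity θ).integrable).abs.mul_const B) ?_
  filter_upwards [hB] with x hx
  rw [← sub_mul, norm_mul, Real.norm_eq_abs, Real.norm_eq_abs, abs_sub_comm]
  exact mul_le_mul_of_nonneg_left hx (abs_nonneg _)

end Scheffe

section Smoothing

variable {E F : Type*} [NormedAddCommGroup E] [NormedSpace ℝ E] [FiniteDimensional ℝ E]
  [MeasurableSpace E] [BorelSpace E] [NormedAddCommGroup F] [NormedSpace ℝ F]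
  {μ : Measure E} [μ.IsAddHaarMeasure]

theorem integrable_comp_sub_smul_smul {m : E → ℝ} (hm : AEStronglyMeasurable m μ) {B : ℝ}
    (hB : ∀ x, |m x| ≤ B) (x₀ : E) {k : E → F} (hk : Integrable k μ) {h : ℝ} (hh : h ≠ 0) :
    Integrable (fun l => m (x₀ - h • l) • k l) μ := by
  have hscale : Measure.QuasiMeasurePreserving (fun l : E => h • l) μ μ :=
    ⟨by fun_prop, by
      rw [Measure.map_addHaar_smul _ hh]
      exact Measure.smul_absolutelyContinuous⟩
  exact hk.bdd_smul B (hm.comp_quasiMeasurePreserving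
    ((Measure.measurePreserving_sub_left μ x₀).quasiMeasurePreserving.comp hscale))
    (ae_of_all _ fun _ => hB _)

theorem tendsto_integral_comp_sub_smul_smul {m : E → ℝ} (hm : AEStronglyMeasurable m μ) {B : ℝ}
    (hB : ∀ x, |m x| ≤ B) {x₀ : E} (hcont : ContinuousAt m x₀) {k : E → F} (hk : Integrable k μ) :
    Tendsto (fun h : ℝ => ∫ l, m (x₀ - h • l) • k l ∂μ) (𝓝[>] 0) (𝓝 (∫ l, m x₀ • k l ∂μ)) := by
  refine tendsto_integral_filter_of_dominated_convergence (fun l => B * ‖k l‖) ?_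
    (.of_forall fun h => ae_of_all _ fun l => ?_) (hk.norm.const_mul B) (ae_of_all _ fun l => ?_)
  · filter_upwards [self_mem_nhdsWithin] with h (hh : 0 < h)
    exact (integrable_comp_sub_smul_smul hm hB x₀ hk hh.ne').aestronglyMeasurable
  · rw [norm_smul]
    exact mul_le_mul_of_nonneg_right (hB _) (norm_nonneg _)
  · have hpoint : Tendsto (fun h : ℝ => x₀ - h • l) (𝓝[>] 0) (𝓝 x₀) :=
      (Continuous.tendsto' (by fun_prop) _ _ (by simp)).mono_left nhdsWithin_le_nhds
    exact (hcont.tendsto.comp hpoint).smul_const (k l)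

end Smoothing

section Polynomials

variable {ι : Type*}

/-- The monomial `u ↦ ∏ i, u (α i)`; the tuple `α` lists the variables with multiplicity. -/
noncomputable def coordMonomial {k : ℕ} (α : Fin k → ι) (u : EuclideanSpace ℝ ι) : ℝ :=
  ∏ i, u (α i)

theorem coordMonomial_smul {k : ℕ} (α : Fin k → ι) (a : ℝ) (u : EuclideanSpace ℝ ι) :
    coordMonomial α (a • u) = a ^ k * coordMonomial α u := by
  simp [coordMonomial, Finset.prod_mul_distrib]

theorem fderiv_coordMonomial_apply [Finite ι] {k : ℕ} (α : Fin k → ι) (u v : EuclideanSpace ℝ ι) :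
    fderiv ℝ (coordMonomial α) u v = ∑ i, v (α i) * ∏ j ∈ Finset.univ.erase i, u (α j) := by
  have := Fintype.ofFinite ι
  have hderiv : HasFDerivAt (coordMonomial α) _ u := HasFDerivAt.finsetProd (u := Finset.univ)
    fun i _ => (EuclideanSpace.proj (α i) : EuclideanSpace ℝ ι →L[ℝ] ℝ).hasFDerivAt
  simp [hderiv.fderiv, mul_comm]

theorem contDiff_coordMonomial [Fintype ι] {k : ℕ} (α : Fin k → ι) {n : WithTop ℕ∞} :
    ContDiff ℝ n (coordMonomial α) :=
  contDiff_prod fun i _ => (EuclideanSpace.proj (α i) : EuclideanSpace ℝ ι →L[ℝ] ℝ).contDiff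

theorem abs_coordMonomial_le [Fintype ι] {k : ℕ} (α : Fin k → ι) (u : EuclideanSpace ℝ ι) :
    |coordMonomial α u| ≤ ‖u‖ ^ k := by
  rw [coordMonomial, Finset.abs_prod]
  refine (Finset.prod_le_prod (fun _ _ => abs_nonneg _) fun i _ =>
    PiLp.norm_apply_le u (α i)).trans ?_
  simp

/-- The polynomial functions of degree less than `m`. -/
noncomputable def polyDegreeLT (ι : Type*) (m : ℕ) : Submodule ℝ (EuclideanSpace ℝ ι → ℝ) :=
  Submodule.span ℝ (Set.range fun a : Σ k : Fin m, Fin k → ι => coordMonomial a.2)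

namespace polyDegreeLT

variable {m k : ℕ} {Q : EuclideanSpace ℝ ι → ℝ}

theorem coordMonomial_mem (hk : k < m) (α : Fin k → ι) : coordMonomial α ∈ polyDegreeLT ι m :=
  Submodule.subset_span ⟨⟨⟨k, hk⟩, α⟩, rfl⟩

theorem prod_mem {κ : Type*} (s : Finset κ) (β : κ → ι) (hs : s.card < m) :
    (fun u : EuclideanSpace ℝ ι => ∏ i ∈ s, u (β i)) ∈ polyDegreeLT ι m := by
  convert! coordMonomial_mem hs fun i => β (s.equivFin.symm i) using 1
  ext u
  rw [coordMonomial, ← Finset.prod_coe_sort]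
  exact (s.equivFin.symm.prod_comp fun i => u (β i)).symm

theorem comp_smul_mem (hQ : Q ∈ polyDegreeLT ι m) (a : ℝ) :
    (fun u => Q (a • u)) ∈ polyDegreeLT ι m := by
  induction hQ using Submodule.span_induction with
  | mem Q h =>
    obtain ⟨⟨k, α⟩, rfl⟩ := h
    simp only [coordMonomial_smul]
    exact Submodule.smul_mem _ _ (coordMonomial_mem k.2 α)
  | zero => exact Submodule.zero_mem _
  | add Q R _ _ hQ hR => exact Submodule.add_mem _ hQ hR
  | smul b Q _ hQ => exact Submodule.smul_mem _ b hQ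

instance [Finite ι] : FiniteDimensional ℝ (polyDegreeLT ι m) :=
  FiniteDimensional.span_of_finite ℝ (Set.finite_range _)

theorem multilinear_diag_mem [Finite ι] (hk : k < m)
    (M : ContinuousMultilinearMap ℝ (fun _ : Fin k => EuclideanSpace ℝ ι) ℝ) :
    (fun u => M fun _ => u) ∈ polyDegreeLT ι m := by
  classical
  have := Fintype.ofFinite ι
  have hM : (fun u => M fun _ => u) = ∑ α : Fin k → ι,
      M (fun i => EuclideanSpace.single (α i) 1) • coordMonomial α := by
    ext u
    have hu : u = ∑ j, u j • EuclideanSpace.single j (1 : ℝ) := by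
      simpa using ((EuclideanSpace.basisFun ι ℝ).sum_repr u).symm
    conv_lhs => rw [hu]
    rw [M.map_sum, Finset.sum_apply]
    refine Finset.sum_congr rfl fun α _ => ?_
    rw [M.map_smul_univ, smul_eq_mul, mul_comm]
    rfl
  rw [hM]
  exact Submodule.sum_mem _ fun α _ => Submodule.smul_mem _ _ (coordMonomial_mem hk α)

theorem contDiff [Fintype ι] (hQ : Q ∈ polyDegreeLT ι m) {n : WithTop ℕ∞} : ContDiff ℝ n Q := by
  induction hQ using Submodule.span_induction with
  | mem Q h => obtain ⟨a, rfl⟩ := h; exact contDiff_coordMonomial a.2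
  | zero => exact contDiff_const
  | add Q R _ _ hQ hR => exact hQ.add hR
  | smul a Q _ hQ => exact contDiff_const.smul hQ

theorem fderiv_apply_mem [Finite ι] (hQ : Q ∈ polyDegreeLT ι (m + 1))
    (v : EuclideanSpace ℝ ι) :
    (fun u => fderiv ℝ Q u v) ∈ polyDegreeLT ι m := by
  classical
  have := Fintype.ofFinite ι
  induction hQ using Submodule.span_induction with
  | mem Q h =>
    obtain ⟨⟨⟨k, hk⟩, α⟩, rfl⟩ := h
    have hderiv : (fun u => fderiv ℝ (coordMonomial α) u v)
        = ∑ i, v (α i) • fun u : EuclideanSpace ℝ ι => ∏ j ∈ Finset.univ.erase i, u (α j) := by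
      ext u
      simp [fderiv_coordMonomial_apply]
    rw [hderiv]
    refine Submodule.sum_mem _ fun i _ => Submodule.smul_mem _ _ (prod_mem _ α ?_)
    have := i.2
    rw [Finset.card_erase_of_mem (Finset.mem_univ i), Finset.card_fin]
    omega
  | zero =>
    simp only [fderiv_zero, Pi.zero_apply, zero_apply]
    exact Submodule.zero_mem _
  | add Q R hQm hRm hQ hR =>
    have hsum : (fun u => fderiv ℝ (Q + R) u v)
        = (fun u => fderiv ℝ Q u v) + fun u => fderiv ℝ R u v := by
      ext u
      rw [fderiv_add ((contDiff hQm (n := 1)).differentiable one_ne_zero u)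
        ((contDiff hRm (n := 1)).differentiable one_ne_zero u)]
      rfl
    exact hsum ▸ Submodule.add_mem _ hQ hR
  | smul b Q hQm hQ =>
    have hsmul : (fun u => fderiv ℝ (b • Q) u v) = b • fun u => fderiv ℝ Q u v := by
      ext u
      rw [fderiv_const_smul ((contDiff hQm (n := 1)).differentiable one_ne_zero u)]
      rfl
    exact hsmul ▸ Submodule.smul_mem _ b hQ

theorem exists_sub_isBigO [Fintype ι] (hQ : Q ∈ polyDegreeLT ι (m + 1)) :
    ∃ R ∈ polyDegreeLT ι m, (fun u => Q u - R u) =O[𝓝 0] fun u => ‖u‖ ^ m := by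
  induction hQ using Submodule.span_induction with
  | mem Q h =>
    obtain ⟨⟨⟨k, hk⟩, α⟩, rfl⟩ := h
    obtain hk | rfl := (Nat.lt_succ_iff.1 hk).lt_or_eq
    · exact ⟨_, coordMonomial_mem hk α, by simpa using Asymptotics.isBigO_zero _ _⟩
    · exact ⟨0, Submodule.zero_mem _, .of_bound' (Eventually.of_forall fun u => by
        simpa using abs_coordMonomial_le α u)⟩
  | zero => exact ⟨0, Submodule.zero_mem _, by simpa using Asymptotics.isBigO_zero _ _⟩
  | add Q₁ Q₂ _ _ h₁ h₂ =>
    obtain ⟨R₁, hR₁, hO₁⟩ := h₁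
    obtain ⟨R₂, hR₂, hO₂⟩ := h₂
    exact ⟨R₁ + R₂, Submodule.add_mem _ hR₁ hR₂, by
      simpa only [Pi.add_apply, add_sub_add_comm] using hO₁.add hO₂⟩
  | smul b Q _ hQ =>
    obtain ⟨R, hR, hO⟩ := hQ
    exact ⟨b • R, Submodule.smul_mem _ b hR, by
      simpa only [Pi.smul_apply, smul_eq_mul, ← mul_sub] using hO.const_mul_left b⟩

end polyDegreeLT

end Polynomials

section FiniteDimensionalAverages

theorem span_range_eval_eq_top {X 𝕜 : Type*} [Field 𝕜] (E : Submodule 𝕜 (X → 𝕜))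
    [FiniteDimensional 𝕜 E] :
    Submodule.span 𝕜 (Set.range fun x : X => (LinearMap.proj x).comp E.subtype)
      = (⊤ : Submodule 𝕜 (Module.Dual 𝕜 E)) := by
  refine Submodule.span_eq_top_of_ne_zero fun g hg => ?_
  by_contra! hzero
  exact hg (Subtype.ext (funext fun x => hzero _ ⟨x, rfl⟩))

variable {X Z : Type*} [MeasurableSpace Z] {μ : Measure Z} (E : Submodule ℝ (X → ℝ))
  [FiniteDimensional ℝ E]

theorem integrable_dual_of_forall_integrable_eval {q : Z → E}
    (hint : ∀ x, Integrable (fun z => (q z : X → ℝ) x) μ) (L : Module.Dual ℝ E) :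
    Integrable (fun z => L (q z)) μ := by
  have hL := (span_range_eval_eq_top E).ge (Submodule.mem_top (x := L))
  induction hL using Submodule.span_induction with
  | mem L h => obtain ⟨x, rfl⟩ := h; exact hint x
  | zero => exact integrable_zero _ _ _
  | add L M _ _ hL hM => exact hL.add hM
  | smul a L _ hL => exact hL.const_mul a

theorem integral_mem_of_finiteDimensional {q : Z → X → ℝ} (hq : ∀ z, q z ∈ E)
    (hint : ∀ x, Integrable (fun z => q z x) μ) : (fun x => ∫ z, q z x ∂μ) ∈ E := by
  let b := Module.finBasis ℝ E
  let c (z : Z) := b.repr ⟨q z, hq z⟩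
  have hc (i) : Integrable (fun z => c z i) μ :=
    integrable_dual_of_forall_integrable_eval E (q := fun z => ⟨q z, hq z⟩) hint (b.coord i)
  have hexpand (z : Z) : q z = ∑ i, c z i • (b i : X → ℝ) := by
    simpa only [map_sum, map_smul, Submodule.subtype_apply] using
      congrArg E.subtype (b.sum_repr ⟨q z, hq z⟩).symm
  have hintegral : (fun x => ∫ z, q z x ∂μ) = ∑ i, (∫ z, c z i ∂μ) • (b i : X → ℝ) := by
    ext x
    simp only [hexpand, Finset.sum_apply, Pi.smul_apply, smul_eq_mul]
    rw [integral_finsetSum _ fun i _ => (hc i).mul_const _]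
    simp only [integral_mul_const]
  rw [hintegral]
  exact Submodule.sum_mem _ fun i _ => Submodule.smul_mem _ _ (b i).2

theorem exists_mem_eqOn_integral_of_finiteDimensional {q : Z → X → ℝ} (hq : ∀ z, q z ∈ E)
    {s : Set X} (hint : ∀ x ∈ s, Integrable (fun z => q z x) μ) :
    ∃ Q ∈ E, Set.EqOn Q (fun x => ∫ z, q z x ∂μ) s := by
  obtain ⟨Q, hQ, hQs⟩ := integral_mem_of_finiteDimensional
    (E.map (LinearMap.funLeft ℝ ℝ (Subtype.val : s → X))) (fun z => Submodule.mem_map_of_mem (hq z))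
    fun x => hint x x.2
  exact ⟨Q, hQ, fun x hx => congrFun hQs ⟨x, hx⟩⟩

end FiniteDimensionalAverages

section Taylor

theorem hasDerivAt_pow_succ_div_factorial (k : ℕ) (t : ℝ) :
    HasDerivAt (fun t : ℝ => t ^ (k + 1) / ((k + 1).factorial : ℝ)) (t ^ k / (k.factorial : ℝ))
      t := by
  convert! (hasDerivAt_pow (k + 1) t).div_const ((k + 1).factorial : ℝ) using 1
  rw [Nat.factorial_succ]
  push_cast
  have : (k.factorial : ℝ) ≠ 0 := by positivity
  field_simp

theorem abs_sub_taylor_le_of_hasDerivAt {m : ℕ} {g : ℕ → ℝ → ℝ}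
    (hg : ∀ k < m, ∀ t, HasDerivAt (g k) (g (k + 1) t) t) {B : ℝ}
    (hB : ∀ t ∈ Set.Icc (0 : ℝ) 1, |g m t - g m 0| ≤ B) :
    ∀ t ∈ Set.Icc (0 : ℝ) 1,
      |g 0 t - ∑ k ∈ Finset.range (m + 1), t ^ k / (k.factorial : ℝ) * g k 0| ≤ B := by
  induction m generalizing g with
  | zero => simpa using hB
  | succ m ih =>
    let R (t : ℝ) := g 0 t - ∑ k ∈ Finset.range (m + 1 + 1), t ^ k / (k.factorial : ℝ) * g k 0
    have hR (t : ℝ) : HasDerivAt R (g 1 t - ∑ k ∈ Finset.range (m + 1),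
        t ^ k / (k.factorial : ℝ) * g (k + 1) 0) t := by
      have hpoly := HasDerivAt.fun_sum fun k (_ : k ∈ Finset.range (m + 1)) =>
        (hasDerivAt_pow_succ_div_factorial k t).mul_const (g (k + 1) 0)
      refine ((hg 0 m.succ_pos t).sub (hpoly.add_const (g 0 0))).congr_of_eventuallyEq
        (Eventually.of_forall fun s => ?_)
      simp [R, Finset.sum_range_succ' _ (m + 1)]
    have hR_deriv := ih (g := fun k => g (k + 1)) (fun k hk t => hg (k + 1) (by omega) t) hB
    have hB_nonneg : 0 ≤ B := (abs_nonneg _).trans (hB 0 (by simp))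
    have hR_zero : R 0 = 0 := by simp [R, Finset.sum_range_succ']
    intro t ht
    have hmvt := norm_image_sub_le_of_norm_deriv_le_segment' (f := R) (a := 0) (b := 1) (C := B)
      (fun s _ => (hR s).hasDerivWithinAt) (fun s hs => hR_deriv s ⟨hs.1, hs.2.le⟩) t ht
    rw [hR_zero, sub_zero, sub_zero] at hmvt
    exact hmvt.trans (mul_le_of_le_one_right hB_nonneg ht.2)

/-- The Taylor polynomial of order `m` of `F` at `x`, as a function of the increment. -/
noncomputable def taylorPolynomial {E : Type*} [NormedAddCommGroup E] [NormedSpace ℝ E] (m : ℕ)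
    (F : E → ℝ) (x u : E) : ℝ :=
  ∑ k ∈ Finset.range (m + 1), (1 / (k.factorial : ℝ)) * iteratedFDeriv ℝ k F x fun _ => u

theorem taylorPolynomial_mem_polyDegreeLT {ι : Type*} [Fintype ι] (m : ℕ)
    (F : EuclideanSpace ℝ ι → ℝ) (x : EuclideanSpace ℝ ι) :
    taylorPolynomial m F x ∈ polyDegreeLT ι (m + 1) := by
  have hsum : taylorPolynomial m F x = ∑ k ∈ Finset.range (m + 1),
      (1 / (k.factorial : ℝ)) • fun u => iteratedFDeriv ℝ k F x fun _ => u := by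
    ext u
    simp [taylorPolynomial]
  rw [hsum]
  exact Submodule.sum_mem _ fun k hk => Submodule.smul_mem _ _
    (polyDegreeLT.multilinear_diag_mem (Finset.mem_range.1 hk) _)

variable {d m k : ℕ}

namespace TimesDifferentiable

variable {F : EuclideanSpace ℝ (Fin d) → ℝ}

theorem hasDerivAt_line (hF : TimesDifferentiable m F) (hk : k < m)
    (x u : EuclideanSpace ℝ (Fin d)) (t : ℝ) :
    HasDerivAt (fun s : ℝ => iteratedFDeriv ℝ k F (x + s • u) fun _ => u)
      (iteratedFDeriv ℝ (k + 1) F (x + t • u) fun _ => u) t := by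
  have hline : HasDerivAt (fun s : ℝ => x + s • u) u t := by
    simpa using ((hasDerivAt_id t).smul_const u).const_add x
  have hcomp := (hF k hk (x + t • u)).hasFDerivAt.comp_hasDerivAt t hline
  rw [iteratedFDeriv_succ_apply_left]
  exact (ContinuousMultilinearMap.apply ℝ (fun _ : Fin k => EuclideanSpace ℝ (Fin d)) ℝ
    fun _ => u).hasFDerivAt.comp_hasDerivAt t hcomp

theorem abs_sub_taylorPolynomial_le (hF : TimesDifferentiable m F)
    {x : EuclideanSpace ℝ (Fin d)} {r A : ℝ}
    (hA : ∀ y ∈ Metric.ball x r, ‖iteratedFDeriv ℝ m F y - iteratedFDeriv ℝ m F x‖ ≤ A)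
    {u : EuclideanSpace ℝ (Fin d)} (hu : u ∈ Metric.ball 0 r) :
    |F (x + u) - taylorPolynomial m F x u| ≤ A * ‖u‖ ^ m := by
  have hosc (t : ℝ) (ht : t ∈ Set.Icc (0 : ℝ) 1) :
      |(iteratedFDeriv ℝ m F (x + t • u) fun _ => u)
        - iteratedFDeriv ℝ m F (x + (0 : ℝ) • u) fun _ => u| ≤ A * ‖u‖ ^ m := by
    have hmem : x + t • u ∈ Metric.ball x r := by
      rw [mem_ball_zero_iff] at hu
      rw [mem_ball_iff_norm, add_sub_cancel_left, norm_smul, Real.norm_of_nonneg ht.1]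
      exact (mul_le_of_le_one_left (norm_nonneg u) ht.2).trans_lt hu
    rw [zero_smul, add_zero, ← sub_apply, ← Real.norm_eq_abs]
    refine ((iteratedFDeriv ℝ m F (x + t • u) - iteratedFDeriv ℝ m F x).le_opNorm _).trans ?_
    rw [Finset.prod_const, Finset.card_fin]
    exact mul_le_mul_of_nonneg_right (hA _ hmem) (by positivity)
  simpa [taylorPolynomial] using abs_sub_taylor_le_of_hasDerivAt (m := m)
    (fun k hk t => hF.hasDerivAt_line hk x u t) hosc 1 (by simp)

end TimesDifferentiable

variable {𝓩 : Type*} [MeasurableSpace 𝓩] {ν : Measure 𝓩} {f : EuclideanSpace ℝ (Fin d) → 𝓩 → ℝ}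

theorem measurable_iteratedFDeriv_apply_const (hf : ∀ lam, Measurable (f lam))
    (hF : ∀ z, TimesDifferentiable m fun lam => f lam z) (hk : k ≤ m)
    (x u : EuclideanSpace ℝ (Fin d)) :
    Measurable fun z => iteratedFDeriv ℝ k (fun lam => f lam z) x fun _ => u := by
  induction k generalizing x with
  | zero => simpa using hf x
  | succ k ih =>
    obtain ⟨s, hs_ne, hs⟩ : ∃ s : ℕ → ℝ, (∀ i, s i ≠ 0) ∧ Tendsto s atTop (𝓝 0) :=
      ⟨fun i => 1 / ((i : ℝ) + 1), fun i => by positivity, tendsto_one_div_add_atTop_nhds_zero_nat⟩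
    have hs' : Tendsto s atTop (𝓝[≠] 0) := tendsto_nhdsWithin_iff.2 ⟨hs, .of_forall hs_ne⟩
    refine measurable_of_tendsto_metrizable (f := fun (i : ℕ) z => (s i)⁻¹ •
      ((iteratedFDeriv ℝ k (fun lam => f lam z) (x + s i • u) fun _ => u)
        - iteratedFDeriv ℝ k (fun lam => f lam z) x fun _ => u))
      (fun i => ((ih (by omega) _).sub (ih (by omega) _)).const_mul _)
      (tendsto_pi_nhds.2 fun z => ?_)
    simpa [Function.comp_def] using
      ((hF z).hasDerivAt_line (k := k) (by omega) x u 0).tendsto_slope_zero.comp hs'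

theorem measurable_taylorPolynomial (hf : ∀ lam, Measurable (f lam))
    (hF : ∀ z, TimesDifferentiable m fun lam => f lam z) (x u : EuclideanSpace ℝ (Fin d)) :
    Measurable fun z => taylorPolynomial m (fun lam => f lam z) x u :=
  Finset.measurable_fun_sum _ fun _ hk => (measurable_iteratedFDeriv_apply_const hf hF
    (Nat.lt_succ_iff.1 (Finset.mem_range.1 hk)) x u).const_mul _

/-- Near `lam0`, the oscillation of `lam ↦ φ(z) ∇^m f(lam, z)` is dominated by one integrable
function of `z`. -/
def DominatedOscillation (m : ℕ) (ν : Measure 𝓩) (f : EuclideanSpace ℝ (Fin d) → 𝓩 → ℝ)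
    (φ : 𝓩 → ℝ) (lam0 : EuclideanSpace ℝ (Fin d)) : Prop :=
  ∃ r > 0, ∃ G : 𝓩 → ℝ, Integrable G ν ∧ ∀ᵐ z ∂ν, ∀ lam ∈ Metric.ball lam0 r,
    |φ z| * ‖iteratedFDeriv ℝ m (fun l => f l z) lam
      - iteratedFDeriv ℝ m (fun l => f l z) lam0‖ ≤ G z

theorem TimesDifferentiable.abs_mul_sub_taylorPolynomial_le {F : EuclideanSpace ℝ (Fin d) → ℝ}
    (hF : TimesDifferentiable m F) {x : EuclideanSpace ℝ (Fin d)} {r a A : ℝ}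
    (hA : ∀ y ∈ Metric.ball x r, |a| * ‖iteratedFDeriv ℝ m F y - iteratedFDeriv ℝ m F x‖ ≤ A)
    {u : EuclideanSpace ℝ (Fin d)} (hu : u ∈ Metric.ball 0 r) :
    |F (x + u) * a - a * taylorPolynomial m F x u| ≤ A * ‖u‖ ^ m := by
  rw [mul_comm, ← mul_sub, abs_mul]
  rcases (abs_nonneg a).eq_or_lt with ha | ha
  · have hA_nonneg : 0 ≤ A := by
      simpa [← ha] using hA x (Metric.mem_ball_self (Metric.pos_of_mem_ball hu))
    rw [← ha, zero_mul]
    positivity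
  · have := hF.abs_sub_taylorPolynomial_le (A := A / |a|)
      (fun y hy => (le_div_iff₀' ha).2 (hA y hy)) hu
    rwa [div_mul_eq_mul_div, le_div_iff₀' ha] at this

theorem IsDensityFamily.exists_densityMean_expansion (hf : IsDensityFamily ν f)
    (hF : ∀ z, TimesDifferentiable m fun lam => f lam z) {φ : 𝓩 → ℝ}
    (hφ : AEStronglyMeasurable φ ν) {B : ℝ} (hB : ∀ᵐ z ∂ν, |φ z| ≤ B)
    {lam0 : EuclideanSpace ℝ (Fin d)} (hdom : DominatedOscillation m ν f φ lam0) :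
    ∃ Q ∈ polyDegreeLT (Fin d) m,
      (fun u => densityMean ν f φ (lam0 + u) - Q u) =O[𝓝 0] fun u => ‖u‖ ^ m := by
  obtain ⟨r, hr, G, hG, hGdom⟩ := hdom
  let q (z : 𝓩) : EuclideanSpace ℝ (Fin d) → ℝ :=
    φ z • taylorPolynomial m (fun lam => f lam z) lam0
  have hrem : ∀ u ∈ Metric.ball 0 r, ∀ᵐ z ∂ν,
      |f (lam0 + u) z * φ z - q z u| ≤ G z * ‖u‖ ^ m := fun u hu => by
    filter_upwards [hGdom] with z hz using (hF z).abs_mul_sub_taylorPolynomial_le hz hu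
  have hq_int : ∀ u ∈ Metric.ball 0 r, Integrable (fun z => q z u) ν := by
    intro u hu
    have hq_meas : AEStronglyMeasurable (fun z => q z u) ν := hφ.mul (measurable_taylorPolynomial
      (fun lam => (hf.isProbDensity lam).measurable) hF lam0 u).aestronglyMeasurable
    have hrem_int : Integrable (fun z => f (lam0 + u) z * φ z - q z u) ν :=
      (hG.mul_const _).mono' ((hf.integrable_mul hφ hB _).aestronglyMeasurable.sub hq_meas)
        (hrem u hu)
    simpa [Pi.sub_def] using (hf.integrable_mul hφ hB (lam0 + u)).sub hrem_int
  -- The coefficients of `q z` need not be integrable a priori; only its values near `0` are.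
  obtain ⟨Q, hQ, hQ_eq⟩ := exists_mem_eqOn_integral_of_finiteDimensional
    (polyDegreeLT (Fin d) (m + 1))
    (fun z => Submodule.smul_mem _ (φ z) (taylorPolynomial_mem_polyDegreeLT m _ lam0)) hq_int
  have hQ_rem : (fun u => densityMean ν f φ (lam0 + u) - Q u) =O[𝓝 0] fun u => ‖u‖ ^ m := by
    refine .of_bound (∫ z, G z ∂ν) ?_
    filter_upwards [Metric.ball_mem_nhds _ hr] with u hu
    rw [hQ_eq hu, densityMean, ← integral_sub (hf.integrable_mul hφ hB _) (hq_int u hu),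
      norm_pow, norm_norm, ← integral_mul_const]
    exact norm_integral_le_of_norm_le (hG.mul_const _) (hrem u hu)
  obtain ⟨R, hR, hQR⟩ := polyDegreeLT.exists_sub_isBigO hQ
  exact ⟨R, hR, by simpa using hQ_rem.add hQR⟩

end Taylor

section Gradient

variable {E : Type*} [NormedAddCommGroup E] [InnerProductSpace ℝ E] [CompleteSpace E] {K : E → ℝ}

theorem continuous_gradient (hK : ContDiff ℝ 1 K) : Continuous (gradient K) :=
  (InnerProductSpace.toDual ℝ E).symm.continuous.comp (hK.continuous_fderiv one_ne_zero)

theorem support_gradient_subset_tsupport (K : E → ℝ) :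
    Function.support (gradient K) ⊆ tsupport K := fun l hl =>
  support_fderiv_subset ℝ fun hfderiv => hl (by rw [gradient, hfderiv, map_zero])

theorem hasCompactSupport_gradient (hK : HasCompactSupport K) : HasCompactSupport (gradient K) :=
  .of_support_subset_isCompact hK (support_gradient_subset_tsupport K)

variable [MeasurableSpace E] [BorelSpace E] {μ : Measure E} [μ.IsAddHaarMeasure]

theorem integrable_gradient (hK : ContDiff ℝ 1 K) (hK_supp : HasCompactSupport K) :
    Integrable (gradient K) μ :=
  (continuous_gradient hK).integrable_of_hasCompactSupport (hasCompactSupport_gradient hK_supp)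

variable [FiniteDimensional ℝ E]

theorem inner_integral_smul_gradient (hK : ContDiff ℝ 1 K) (hK_supp : HasCompactSupport K)
    {q : E → ℝ} (hq : ContDiff ℝ 1 q) (v : E) :
    inner ℝ v (∫ l, q l • gradient K l ∂μ) = -∫ l, fderiv ℝ q l v * K l ∂μ := by
  have hint : Integrable (fun l => q l • gradient K l) μ :=
    (hq.continuous.smul (continuous_gradient hK)).integrable_of_hasCompactSupport
      (hasCompactSupport_gradient hK_supp).smul_left
  have hinner (l : E) : inner ℝ v (q l • gradient K l) = q l * fderiv ℝ K l v := by
    rw [real_inner_smul_right, real_inner_comm, inner_gradient_left]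
  rw [← integral_inner hint]
  simp only [hinner]
  refine integral_mul_fderiv_eq_neg_fderiv_mul_of_integrable ?_ ?_ ?_
    (fun x _ => hq.differentiable one_ne_zero x) (fun x _ => hK.differentiable one_ne_zero x)
  · exact (((hq.continuous_fderiv one_ne_zero).clm_apply continuous_const).mul
      hK.continuous).integrable_of_hasCompactSupport hK_supp.mul_left
  · simpa only [hinner] using hint.const_inner (𝕜 := ℝ) v
  · exact (hq.continuous.mul hK.continuous).integrable_of_hasCompactSupport hK_supp.mul_left

theorem integral_gradient_eq_zero (hK : ContDiff ℝ 1 K) (hK_supp : HasCompactSupport K) :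
    ∫ l, gradient K l ∂μ = 0 :=
  ext_inner_left ℝ fun v => by
    simpa using inner_integral_smul_gradient (μ := μ) hK hK_supp (q := fun _ => 1) contDiff_const v

end Gradient

section Bias

variable {ι : Type*} [Fintype ι] {K : EuclideanSpace ℝ ι → ℝ} {p : ℕ}

/-- `K` has integral one and all its moments of the orders `1, …, p - 1` vanish, so that averaging
against `K` reproduces the polynomials of degree less than `p`. -/
structure HasVanishingMoments (K : EuclideanSpace ℝ ι → ℝ) (p : ℕ) : Prop where
  integral_eq_one : ∫ l, K l = 1
  moment_eq_zero : ∀ r, 0 < r → r < p → ∀ α : Fin r → ι, ∫ l, coordMonomial α l * K l = 0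

namespace HasVanishingMoments

theorem integral_mul_eq_apply_zero (hK : HasVanishingMoments K p) (hK_cont : Continuous K)
    (hK_supp : HasCompactSupport K) {Q : EuclideanSpace ℝ ι → ℝ} (hQ : Q ∈ polyDegreeLT ι p) :
    ∫ l, Q l * K l = Q 0 := by
  have hint {Q : EuclideanSpace ℝ ι → ℝ} (hQ : Q ∈ polyDegreeLT ι p) :
      Integrable fun l => Q l * K l :=
    ((polyDegreeLT.contDiff hQ (n := 0)).continuous.mul
      hK_cont).integrable_of_hasCompactSupport hK_supp.mul_left
  induction hQ using Submodule.span_induction with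
  | mem Q h =>
    obtain ⟨⟨⟨r, hr⟩, α⟩, rfl⟩ := h
    obtain rfl | hr_pos := r.eq_zero_or_pos
    · simp [coordMonomial, hK.integral_eq_one]
    · rw [hK.moment_eq_zero r hr_pos hr α]
      simp [coordMonomial, hr_pos.ne']
  | zero => simp
  | add Q R hQm hRm hQ hR =>
    simp only [Pi.add_apply, add_mul]
    rw [integral_add (hint hQm) (hint hRm), hQ, hR]
  | smul a Q _ hQ =>
    simp only [Pi.smul_apply, smul_eq_mul, mul_assoc, integral_const_mul, hQ]

theorem integral_comp_smul_smul_gradient (hK : HasVanishingMoments K p) (hK_diff : ContDiff ℝ 1 K)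
    (hK_supp : HasCompactSupport K) {Q : EuclideanSpace ℝ ι → ℝ}
    (hQ : Q ∈ polyDegreeLT ι (p + 1)) (a : ℝ) :
    ∫ l, Q (a • l) • gradient K l = -(a • gradient Q 0) := by
  have hQa := polyDegreeLT.comp_smul_mem hQ a
  refine ext_inner_left ℝ fun v => ?_
  rw [inner_integral_smul_gradient hK_diff hK_supp (polyDegreeLT.contDiff hQa),
    hK.integral_mul_eq_apply_zero hK_diff.continuous hK_supp
      (polyDegreeLT.fderiv_apply_mem hQa v), fderiv_comp_smul, smul_zero, inner_neg_right,
    real_inner_smul_right, real_inner_comm, inner_gradient_left]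
  rfl

end HasVanishingMoments

theorem isBigO_integral_comp_smul_smul {E F : Type*} [NormedAddCommGroup E] [NormedSpace ℝ E]
    [MeasurableSpace E] {μ : Measure E} [NormedAddCommGroup F] [NormedSpace ℝ F] {m : ℕ}
    {W : E → ℝ} (hW : W =O[𝓝 0] fun u => ‖u‖ ^ m) {k : E → F} (hk : Integrable k μ)
    (hk_supp : HasCompactSupport k) :
    (fun a : ℝ => ∫ l, W (a • l) • k l ∂μ) =O[𝓝 0] fun a => a ^ m := by
  obtain ⟨C, hC_pos, hC⟩ := hW.exists_pos
  obtain ⟨δ, hδ, hCδ⟩ := Metric.eventually_nhds_iff_ball.1 hC.bound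
  obtain ⟨R, hR_pos, hR⟩ := hk_supp.isCompact.isBounded.subset_ball_lt 0 0
  refine .of_bound (∫ l, C * R ^ m * ‖k l‖ ∂μ) ?_
  filter_upwards [Metric.ball_mem_nhds 0 (div_pos hδ hR_pos)] with a ha
  rw [← integral_mul_const]
  refine norm_integral_le_of_norm_le ((hk.norm.const_mul _).mul_const _) (ae_of_all _ fun l => ?_)
  by_cases hl : l ∈ tsupport k
  · have hlR : ‖l‖ < R := mem_ball_zero_iff.1 (hR hl)
    have hal : a • l ∈ Metric.ball 0 δ := by
      rw [mem_ball_zero_iff, lt_div_iff₀ hR_pos] at ha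
      rw [mem_ball_zero_iff, norm_smul]
      exact (mul_le_mul_of_nonneg_left hlR.le (norm_nonneg a)).trans_lt ha
    calc ‖W (a • l) • k l‖ = ‖W (a • l)‖ * ‖k l‖ := norm_smul _ _
      _ ≤ C * (‖a‖ * ‖l‖) ^ m * ‖k l‖ := by
        gcongr
        simpa [norm_smul] using hCδ _ hal
      _ ≤ C * (‖a‖ * R) ^ m * ‖k l‖ := by gcongr
      _ = C * R ^ m * ‖k l‖ * ‖a ^ m‖ := by rw [norm_pow]; ring
  · simp [image_eq_zero_of_notMem_tsupport hl]

variable {V Q : EuclideanSpace ℝ ι → ℝ} {lam0 : EuclideanSpace ℝ ι}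

theorem hasGradientAt_of_isBigO_sub_polyDegreeLT {m n : ℕ} (hQ : Q ∈ polyDegreeLT ι m)
    (hn : 1 < n) (hVQ : (fun u => V (lam0 + u) - Q u) =O[𝓝 0] fun u => ‖u‖ ^ n) :
    HasGradientAt V (gradient Q 0) lam0 := by
  have hrem : HasFDerivAt (fun u => V (lam0 + u) - Q u)
      (0 : EuclideanSpace ℝ ι →L[ℝ] ℝ) 0 :=
    Asymptotics.IsBigO.hasFDerivAt (by simpa using hVQ) hn
  have hQ' := ((polyDegreeLT.contDiff hQ (n := 1)).differentiable one_ne_zero 0).hasGradientAt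
  have hshift := (hrem.add hQ'.hasFDerivAt).congr_of_eventuallyEq
    (f₁ := fun u => V (lam0 + u)) (.of_forall fun u => by simp)
  rw [hasGradientAt_iff_hasFDerivAt]
  simpa using (hasFDerivAt_comp_add_left lam0).1 hshift

theorem HasVanishingMoments.isBigO_smoothed_gradient_sub (hK : HasVanishingMoments K p)
    (hK_diff : ContDiff ℝ 1 K) (hK_supp : HasCompactSupport K)
    (hV : AEStronglyMeasurable V volume) {B : ℝ} (hB : ∀ x, |V x| ≤ B)
    (hQ : Q ∈ polyDegreeLT ι (p + 1))
    (hVQ : (fun u => V (lam0 + u) - Q u) =O[𝓝 0] fun u => ‖u‖ ^ (p + 1)) :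
    (fun h : ℝ => h⁻¹ • (∫ l, V (lam0 - h • l) • gradient K l) - gradient Q 0)
      =O[𝓝[≠] 0] fun h => h ^ p := by
  have hgrad_int : Integrable (gradient K) := integrable_gradient hK_diff hK_supp
  have hgrad_supp := hasCompactSupport_gradient hK_supp
  have hneg : Tendsto (fun h : ℝ => -h) (𝓝[≠] 0) (𝓝 0) :=
    (continuous_neg.tendsto' 0 0 neg_zero).mono_left nhdsWithin_le_nhds
  have hrem : (fun h : ℝ => ∫ l, (V (lam0 + -h • l) - Q (-h • l)) • gradient K l)
      =O[𝓝[≠] 0] fun h => h ^ (p + 1) := by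
    refine ((isBigO_integral_comp_smul_smul hVQ hgrad_int hgrad_supp).comp_tendsto hneg).trans ?_
    exact Asymptotics.isBigO_of_le _ fun h => by simp
  have hexact (h : ℝ) (hh : h ≠ 0) :
      h⁻¹ • (∫ l, (V (lam0 + -h • l) - Q (-h • l)) • gradient K l)
        = h⁻¹ • (∫ l, V (lam0 - h • l) • gradient K l) - gradient Q 0 := by
    have hV_int := integrable_comp_sub_smul_smul hV hB lam0 hgrad_int hh
    have hQ_int : Integrable fun l => Q (-h • l) • gradient K l :=
      ((polyDegreeLT.contDiff (polyDegreeLT.comp_smul_mem hQ (-h)) (n := 0)).continuous.smul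
        (continuous_gradient hK_diff)).integrable_of_hasCompactSupport hgrad_supp.smul_left
    have hpoint (l : EuclideanSpace ℝ ι) : lam0 + -h • l = lam0 - h • l := by
      rw [neg_smul, sub_eq_add_neg]
    simp only [hpoint, sub_smul]
    rw [integral_sub hV_int hQ_int, hK.integral_comp_smul_smul_gradient hK_diff hK_supp hQ,
      neg_smul, neg_neg, smul_sub, inv_smul_smul₀ hh]
  refine ((Asymptotics.isBigO_refl (fun h : ℝ => h⁻¹) _).smul hrem).congr' ?_ ?_ <;>
    filter_upwards [self_mem_nhdsWithin] with h (hh : h ≠ 0)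
  · exact hexact h hh
  · rw [smul_eq_mul, pow_succ', inv_mul_cancel_left₀ hh]

end Bias

section AsymptoticCovariance

open scoped RealInnerProductSpace

variable {d : ℕ} {K : EuclideanSpace ℝ (Fin d) → ℝ}

theorem continuous_inner_gradient (hK : ContDiff ℝ 1 K) (t : EuclideanSpace ℝ (Fin d)) :
    Continuous fun l => ⟪gradient K l, t⟫ :=
  (continuous_gradient hK).inner continuous_const

theorem support_gradient_subset_closedCube {ε : ℝ}
    (hK_supp : Function.support K ⊆ closedCube d ε) :
    Function.support (gradient K) ⊆ closedCube d ε :=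
  (support_gradient_subset_tsupport K).trans
    (closure_minimal hK_supp (isCompact_closedCube d ε).isClosed)

theorem dotProduct_asymptoticCovariance_mulVec (hK : ContDiff ℝ 1 K)
    (hK_supp : HasCompactSupport K) (m : ℝ) (t : EuclideanSpace ℝ (Fin d)) :
    t.ofLp ⬝ᵥ (asymptoticCovariance K m).mulVec t.ofLp
      = (2 : ℝ) ^ d * m * ∫ l, ⟪gradient K l, t⟫ ^ 2 := by
  have hcoord (j : Fin d) : Continuous fun l => gradient K l j :=
    (EuclideanSpace.proj j).continuous.comp (continuous_gradient hK)
  have hint (i j : Fin d) :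
      Integrable fun l => t i * (t j * (gradient K l i * gradient K l j)) := by
    refine Continuous.integrable_of_hasCompactSupport
      (continuous_const.mul (continuous_const.mul ((hcoord i).mul (hcoord j))))
      ((hasCompactSupport_gradient hK_supp).mono fun l hl hgrad => hl ?_)
    simp [hgrad]
  have hexpand (l : EuclideanSpace ℝ (Fin d)) : ⟪gradient K l, t⟫ ^ 2
      = ∑ i, ∑ j, t i * (t j * (gradient K l i * gradient K l j)) := by
    rw [PiLp.inner_apply, sq, Finset.sum_mul_sum]
    refine Finset.sum_congr rfl fun i _ => Finset.sum_congr rfl fun j _ => ?_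
    simp only [RCLike.inner_apply, conj_trivial]
    ring
  simp only [hexpand, integral_finsetSum _ fun i _ => integrable_finsetSum _ fun j _ => hint i j,
    integral_finsetSum _ fun j _ => hint _ j, integral_const_mul, dotProduct, Matrix.mulVec,
    asymptoticCovariance, Matrix.of_apply, Finset.mul_sum]
  refine Finset.sum_congr rfl fun i _ => Finset.sum_congr rfl fun j _ => ?_
  ring

theorem posSemidef_asymptoticCovariance (hK : ContDiff ℝ 1 K) (hK_supp : HasCompactSupport K)
    {m : ℝ} (hm : 0 ≤ m) : (asymptoticCovariance K m).PosSemidef := by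
  refine .of_dotProduct_mulVec_nonneg ?_ fun t => ?_
  · ext i j
    simp only [asymptoticCovariance, Matrix.conjTranspose_apply, Matrix.of_apply, star_trivial,
      mul_comm (gradient K _ i)]
  · rw [star_trivial, ← WithLp.ofLp_toLp 2 t,
      dotProduct_asymptoticCovariance_mulVec hK hK_supp]
    exact mul_nonneg (by positivity) (integral_nonneg fun l => sq_nonneg _)

end AsymptoticCovariance

section Score

open scoped RealInnerProductSpace

variable {d : ℕ} {𝓩 : Type*} {K : EuclideanSpace ℝ (Fin d) → ℝ}
  {f : EuclideanSpace ℝ (Fin d) → 𝓩 → ℝ} {φ : 𝓩 → ℝ} {lam0 : EuclideanSpace ℝ (Fin d)} {B : ℝ}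

/-- The contribution of one observation `q = (Λ, Z)` to the estimator, the factor `(N h)⁻¹` being
left out. -/
noncomputable def kernelScore (K : EuclideanSpace ℝ (Fin d) → ℝ) (φ : 𝓩 → ℝ)
    (lam0 : EuclideanSpace ℝ (Fin d)) (h : ℝ) (q : EuclideanSpace ℝ (Fin d) × 𝓩) :
    EuclideanSpace ℝ (Fin d) :=
  (2 : ℝ) ^ d • φ q.2 • gradient K (h⁻¹ • (lam0 - q.1))

/-- The estimator `uniformKernelEstimator` for observations in an arbitrary sample space. -/
noncomputable def kernelEstimator (K : EuclideanSpace ℝ (Fin d) → ℝ) (φ : 𝓩 → ℝ)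
    (lam0 : EuclideanSpace ℝ (Fin d)) (N : ℕ) (h : ℝ)
    (q : Fin N → EuclideanSpace ℝ (Fin d) × 𝓩) : EuclideanSpace ℝ (Fin d) :=
  ((2 : ℝ) ^ d / (N * h)) • ∑ i, φ (q i).2 • gradient K (h⁻¹ • (lam0 - (q i).1))

theorem kernelEstimator_eq_smul_sum_kernelScore (K : EuclideanSpace ℝ (Fin d) → ℝ) (φ : 𝓩 → ℝ)
    (lam0 : EuclideanSpace ℝ (Fin d)) (N : ℕ) (h : ℝ)
    (q : Fin N → EuclideanSpace ℝ (Fin d) × 𝓩) :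
    kernelEstimator K φ lam0 N h q = (N * h)⁻¹ • ∑ i, kernelScore K φ lam0 h (q i) := by
  simp only [kernelEstimator, kernelScore]
  rw [← Finset.smul_sum, smul_smul, div_eq_inv_mul]

variable [MeasurableSpace 𝓩] {ν : Measure 𝓩}

theorem ae_abs_sq_le (hB : ∀ᵐ z ∂ν, |φ z| ≤ B) : ∀ᵐ z ∂ν, |φ z ^ 2| ≤ B ^ 2 := by
  filter_upwards [hB] with z hz
  rw [abs_pow]
  gcongr

theorem ae_norm_kernelScore_le {A : ℝ} (hA : ∀ l, ‖gradient K l‖ ≤ A)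
    (hB : ∀ᵐ z ∂ν, |φ z| ≤ B) (f : EuclideanSpace ℝ (Fin d) → 𝓩 → ℝ)
    (lam0 : EuclideanSpace ℝ (Fin d)) (h : ℝ) :
    ∀ᵐ q ∂(localizedLaw ν f lam0 h), ‖kernelScore K φ lam0 h q‖ ≤ 2 ^ d * (B * A) := by
  filter_upwards [(densityLaw_absolutelyContinuous _ _).ae_le
    (Measure.quasiMeasurePreserving_snd.ae hB)] with q hq
  rw [kernelScore, norm_smul, norm_smul, norm_pow, Real.norm_ofNat]
  gcongr
  · exact (abs_nonneg _).trans hq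
  · exact hq
  · exact hA _

namespace IsDensityFamily

variable [SFinite ν]

theorem integrable_kernelScore (hf : IsDensityFamily ν f) (hφ : AEStronglyMeasurable φ ν)
    (hB : ∀ᵐ z ∂ν, |φ z| ≤ B) (hK : ContDiff ℝ 1 K) (hK_supp : HasCompactSupport K) {h : ℝ}
    (hh : 0 < h) : Integrable (kernelScore K φ lam0 h) (localizedLaw ν f lam0 h) := by
  have hgrad := continuous_gradient hK
  obtain ⟨A, hA⟩ := (hasCompactSupport_gradient hK_supp).exists_bound_of_continuous hgrad
  exact (hf.integrable_smul_prod (isProbDensity_uniformCubeDensity_sub lam0 hh) hφ hB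
    (G := fun lam => gradient K (h⁻¹ • (lam0 - lam)))
    (hgrad.comp (by fun_prop)).aestronglyMeasurable fun _ => hA _).smul ((2 : ℝ) ^ d)

theorem integral_kernelScore (hf : IsDensityFamily ν f) (hφ : AEStronglyMeasurable φ ν)
    (hB : ∀ᵐ z ∂ν, |φ z| ≤ B) (hK : ContDiff ℝ 1 K)
    (hK_supp : Function.support K ⊆ closedCube d 1) {h : ℝ} (hh : 0 < h) :
    ∫ q, kernelScore K φ lam0 h q ∂(localizedLaw ν f lam0 h)
      = ∫ l, densityMean ν f φ (lam0 - h • l) • gradient K l := by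
  simp only [kernelScore]
  rw [integral_smul, hf.integral_localizedLaw lam0 hh hφ hB (continuous_gradient hK)
    (support_gradient_subset_closedCube hK_supp), smul_inv_smul₀ (by positivity)]

theorem integral_inner_kernelScore_sq (hf : IsDensityFamily ν f) (hφ : AEStronglyMeasurable φ ν)
    (hB : ∀ᵐ z ∂ν, |φ z| ≤ B) (hK : ContDiff ℝ 1 K)
    (hK_supp : Function.support K ⊆ closedCube d 1) {h : ℝ} (hh : 0 < h)
    (t : EuclideanSpace ℝ (Fin d)) :
    ∫ q, ⟪kernelScore K φ lam0 h q, t⟫ ^ 2 ∂(localizedLaw ν f lam0 h)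
      = 2 ^ d * ∫ l, densityMean ν f (fun z => φ z ^ 2) (lam0 - h • l) • ⟪gradient K l, t⟫ ^ 2 := by
  have hsupp : Function.support (fun l => ⟪gradient K l, t⟫ ^ 2) ⊆ closedCube d 1 := fun l hl =>
    support_gradient_subset_closedCube hK_supp fun hgrad => hl <| by
      simp only [hgrad, inner_zero_left, zero_pow two_ne_zero]
  have hsq := hf.integral_localizedLaw (ψ := fun z => φ z ^ 2)
    (k := fun l => ⟪gradient K l, t⟫ ^ 2) lam0 hh (hφ.pow 2) (ae_abs_sq_le hB)
    ((continuous_inner_gradient hK t).pow 2) hsupp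
  simp only [smul_eq_mul] at hsq
  simp only [kernelScore, real_inner_smul_left, mul_pow, integral_const_mul, smul_eq_mul]
  rw [hsq]
  field_simp

theorem variance_inner_kernelScore (hf : IsDensityFamily ν f) (hφ : AEStronglyMeasurable φ ν)
    (hB : ∀ᵐ z ∂ν, |φ z| ≤ B) (hK : ContDiff ℝ 1 K)
    (hK_supp : Function.support K ⊆ closedCube d 1) {h : ℝ} (hh : 0 < h)
    (t : EuclideanSpace ℝ (Fin d)) :
    Var[fun q => ⟪kernelScore K φ lam0 h q, t⟫; localizedLaw ν f lam0 h]
      = 2 ^ d * (∫ l, densityMean ν f (fun z => φ z ^ 2) (lam0 - h • l) • ⟪gradient K l, t⟫ ^ 2)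
        - ⟪∫ l, densityMean ν f φ (lam0 - h • l) • gradient K l, t⟫ ^ 2 := by
  have hK_compact := hasCompactSupport_of_support_subset_closedCube hK_supp
  obtain ⟨A, hA⟩ := (hasCompactSupport_gradient hK_compact).exists_bound_of_continuous
    (continuous_gradient hK)
  have := hf.isProbabilityMeasure_localizedLaw lam0 hh
  have hint := hf.integrable_kernelScore (lam0 := lam0) hφ hB hK hK_compact hh
  have hmem : MemLp (fun q => ⟪kernelScore K φ lam0 h q, t⟫) 2 (localizedLaw ν f lam0 h) := by
    refine .of_bound (hint.inner_const t).aestronglyMeasurable (2 ^ d * (B * A) * ‖t‖) ?_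
    filter_upwards [ae_norm_kernelScore_le hA hB f lam0 h] with q hq
    exact (norm_inner_le_norm _ _).trans (by gcongr)
  have hmean : ∫ q, ⟪kernelScore K φ lam0 h q, t⟫ ∂(localizedLaw ν f lam0 h)
      = ⟪∫ q, kernelScore K φ lam0 h q ∂(localizedLaw ν f lam0 h), t⟫ := by
    simp only [real_inner_comm t, integral_inner hint]
  rw [variance_eq_sub hmem, hmean, hf.integral_kernelScore hφ hB hK hK_supp hh]
  simp only [Pi.pow_apply, hf.integral_inner_kernelScore_sq hφ hB hK hK_supp hh]

theorem tendsto_variance_inner_kernelScore (hf : IsDensityFamily ν f)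
    (hf_cont : ∀ᵐ z ∂ν, ContinuousAt (fun lam => f lam z) lam0) (hφ : AEStronglyMeasurable φ ν)
    (hB : ∀ᵐ z ∂ν, |φ z| ≤ B) (hK : ContDiff ℝ 1 K)
    (hK_supp : Function.support K ⊆ closedCube d 1) (t : EuclideanSpace ℝ (Fin d)) :
    Tendsto (fun h => Var[fun q => ⟪kernelScore K φ lam0 h q, t⟫; localizedLaw ν f lam0 h])
      (𝓝[>] 0) (𝓝 (t.ofLp ⬝ᵥ (asymptoticCovariance K
        (densityMean ν f (fun z => φ z ^ 2) lam0)).mulVec t.ofLp)) := by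
  have hK_compact := hasCompactSupport_of_support_subset_closedCube hK_supp
  have hfirst := tendsto_integral_comp_sub_smul_smul
    (hf.aestronglyMeasurable_densityMean hφ volume) (hf.abs_densityMean_le hB)
    (hf.continuousAt_densityMean hf_cont hφ hB) (integrable_gradient hK hK_compact)
  rw [integral_smul, integral_gradient_eq_zero hK hK_compact, smul_zero] at hfirst
  have hint_sq : Integrable fun l => ⟪gradient K l, t⟫ ^ 2 :=
    ((continuous_inner_gradient hK t).pow 2).integrable_of_hasCompactSupport <|
      (hasCompactSupport_gradient hK_compact).mono fun l hl hgrad => hl <| by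
        simp only [hgrad, inner_zero_left, zero_pow two_ne_zero, Pi.pow_apply]
  have hφ_sq : AEStronglyMeasurable (fun z => φ z ^ 2) ν := hφ.pow 2
  have hsecond := tendsto_integral_comp_sub_smul_smul
    (hf.aestronglyMeasurable_densityMean hφ_sq volume) (hf.abs_densityMean_le (ae_abs_sq_le hB))
    (hf.continuousAt_densityMean hf_cont hφ_sq (ae_abs_sq_le hB)) hint_sq
  have hlim := (hsecond.const_mul (2 ^ d)).sub ((hfirst.inner (tendsto_const_nhds (x := t))).pow 2)
  rw [dotProduct_asymptoticCovariance_mulVec hK hK_compact]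
  simp only [smul_eq_mul, integral_const_mul, ← mul_assoc, inner_zero_left,
    zero_pow two_ne_zero, sub_zero] at hlim
  refine hlim.congr' ?_
  filter_upwards [self_mem_nhdsWithin] with h hh
  exact (hf.variance_inner_kernelScore hφ hB hK hK_supp hh t).symm

end IsDensityFamily

end Score

section Estimator

variable {d p : ℕ} {𝓩 Ω : Type*} [MeasurableSpace 𝓩] [MeasurableSpace Ω] {ν : Measure 𝓩}
  [SFinite ν] {P : Measure Ω} {K : EuclideanSpace ℝ (Fin d) → ℝ}
  {f : EuclideanSpace ℝ (Fin d) → 𝓩 → ℝ} {φ : 𝓩 → ℝ} {lam0 : EuclideanSpace ℝ (Fin d)} {B : ℝ}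

theorem sqrt_natCast_mul_sq_mul_inv {h : ℝ} (hh : 0 < h) (N : ℕ) :
    √((N : ℝ) * h ^ 2) * ((N : ℝ) * h)⁻¹ = (√(N : ℝ))⁻¹ := by
  rw [Real.sqrt_mul N.cast_nonneg, Real.sqrt_sq hh.le, ← div_eq_mul_inv,
    mul_div_mul_right _ _ hh.ne', Real.sqrt_div_self]

namespace IsDensityFamily

section Sample

variable {N : ℕ} {h : ℝ} {X : Fin N → Ω → EuclideanSpace ℝ (Fin d) × 𝓩}

theorem integrable_kernelScore_comp (hf : IsDensityFamily ν f) (hφ : AEStronglyMeasurable φ ν)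
    (hB : ∀ᵐ z ∂ν, |φ z| ≤ B) (hK : ContDiff ℝ 1 K) (hK_supp : HasCompactSupport K) (hh : 0 < h)
    (hX : ∀ i, HasLaw (X i) (localizedLaw ν f lam0 h) P) (i : Fin N) :
    Integrable (fun ω => kernelScore K φ lam0 h (X i ω)) P := by
  have hint := hf.integrable_kernelScore (lam0 := lam0) hφ hB hK hK_supp hh
  rw [← (hX i).map_eq] at hint
  exact hint.comp_aemeasurable (hX i).aemeasurable

theorem integrable_kernelEstimator (hf : IsDensityFamily ν f) (hφ : AEStronglyMeasurable φ ν)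
    (hB : ∀ᵐ z ∂ν, |φ z| ≤ B) (hK : ContDiff ℝ 1 K) (hK_supp : HasCompactSupport K) (hh : 0 < h)
    (hX : ∀ i, HasLaw (X i) (localizedLaw ν f lam0 h) P) :
    Integrable (fun ω => kernelEstimator K φ lam0 N h fun i => X i ω) P := by
  simp only [kernelEstimator_eq_smul_sum_kernelScore]
  exact (integrable_finsetSum _ fun i _ =>
    hf.integrable_kernelScore_comp hφ hB hK hK_supp hh hX i).smul ((N : ℝ) * h)⁻¹

theorem integral_kernelEstimator (hf : IsDensityFamily ν f) (hφ : AEStronglyMeasurable φ ν)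
    (hB : ∀ᵐ z ∂ν, |φ z| ≤ B) (hK : ContDiff ℝ 1 K) (hK_supp : HasCompactSupport K) (hh : 0 < h)
    (hX : ∀ i, HasLaw (X i) (localizedLaw ν f lam0 h) P) :
    ∫ ω, kernelEstimator K φ lam0 N h (fun i => X i ω) ∂P
      = ((N : ℝ) * h)⁻¹ • (N : ℝ) • ∫ q, kernelScore K φ lam0 h q ∂(localizedLaw ν f lam0 h) := by
  have hmeas := (hf.integrable_kernelScore (lam0 := lam0) hφ hB hK hK_supp hh).1
  simp only [kernelEstimator_eq_smul_sum_kernelScore, integral_smul,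
    integral_finsetSum _ fun i _ => hf.integrable_kernelScore_comp hφ hB hK hK_supp hh hX i,
    fun i => show ∫ ω, kernelScore K φ lam0 h (X i ω) ∂P = _ from (hX i).integral_comp hmeas,
    Finset.sum_const, Finset.card_univ, Fintype.card_fin, Nat.cast_smul_eq_nsmul]

theorem sqrt_smul_kernelEstimator_sub_integral (hf : IsDensityFamily ν f)
    (hφ : AEStronglyMeasurable φ ν) (hB : ∀ᵐ z ∂ν, |φ z| ≤ B) (hK : ContDiff ℝ 1 K)
    (hK_supp : HasCompactSupport K) (hh : 0 < h)
    (hX : ∀ i, HasLaw (X i) (localizedLaw ν f lam0 h) P)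
    (q : Fin N → EuclideanSpace ℝ (Fin d) × 𝓩) :
    √((N : ℝ) * h ^ 2) • (kernelEstimator K φ lam0 N h q
        - ∫ ω, kernelEstimator K φ lam0 N h (fun i => X i ω) ∂P)
      = (√(N : ℝ))⁻¹ • ∑ i, (kernelScore K φ lam0 h (q i)
        - ∫ q', kernelScore K φ lam0 h q' ∂(localizedLaw ν f lam0 h)) := by
  rw [hf.integral_kernelEstimator hφ hB hK hK_supp hh hX,
    kernelEstimator_eq_smul_sum_kernelScore, ← smul_sub, smul_smul, sqrt_natCast_mul_sq_mul_inv hh,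
    Finset.sum_sub_distrib, Finset.sum_const, Finset.card_univ, Fintype.card_fin,
    Nat.cast_smul_eq_nsmul]

end Sample

variable {h : ℕ → ℝ} {X : (N : ℕ) → Fin N → Ω → EuclideanSpace ℝ (Fin d) × 𝓩}

theorem exists_hasGradientAt_and_isBigO_bias (hf : IsDensityFamily ν f)
    (hF : ∀ z, TimesDifferentiable (p + 1) fun lam => f lam z) (hφ : AEStronglyMeasurable φ ν)
    (hB : ∀ᵐ z ∂ν, |φ z| ≤ B) (hdom : DominatedOscillation (p + 1) ν f φ lam0) (hp : 0 < p)
    (hK : ContDiff ℝ 1 K) (hK_supp : Function.support K ⊆ closedCube d 1)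
    (hK_moments : HasVanishingMoments K p) :
    ∃ β, HasGradientAt (densityMean ν f φ) β lam0 ∧
      (fun h : ℝ => h⁻¹ • (∫ q, kernelScore K φ lam0 h q ∂(localizedLaw ν f lam0 h)) - β)
        =O[𝓝[>] 0] fun h => h ^ p := by
  obtain ⟨Q, hQ, hVQ⟩ := hf.exists_densityMean_expansion hF hφ hB hdom
  refine ⟨gradient Q 0, hasGradientAt_of_isBigO_sub_polyDegreeLT hQ (by omega) hVQ, ?_⟩
  refine ((hK_moments.isBigO_smoothed_gradient_sub hK
    (hasCompactSupport_of_support_subset_closedCube hK_supp)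
    (hf.aestronglyMeasurable_densityMean hφ volume) (hf.abs_densityMean_le hB) hQ hVQ).mono
    (nhdsWithin_mono _ fun _ => ne_of_gt)).congr' ?_ .rfl
  filter_upwards [self_mem_nhdsWithin] with h hh
  rw [hf.integral_kernelScore hφ hB hK hK_supp hh]

theorem isBigO_integral_kernelEstimator_sub (hf : IsDensityFamily ν f)
    (hφ : AEStronglyMeasurable φ ν) (hB : ∀ᵐ z ∂ν, |φ z| ≤ B) (hK : ContDiff ℝ 1 K)
    (hK_supp : HasCompactSupport K) (h_pos : ∀ N, 0 < h N) (h_lim : Tendsto h atTop (𝓝 0))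
    (hX : ∀ N i, HasLaw (X N i) (localizedLaw ν f lam0 (h N)) P) {β : EuclideanSpace ℝ (Fin d)}
    (hbias : (fun h : ℝ => h⁻¹ • (∫ q, kernelScore K φ lam0 h q ∂(localizedLaw ν f lam0 h)) - β)
      =O[𝓝[>] 0] fun h => h ^ p) :
    (fun N => ∫ ω, kernelEstimator K φ lam0 N (h N) (fun i => X N i ω) ∂P - β)
      =O[atTop] fun N => h N ^ p := by
  refine (hbias.comp_tendsto (tendsto_nhdsWithin_iff.2 ⟨h_lim, .of_forall h_pos⟩)).congr' ?_ .rfl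
  filter_upwards [eventually_ne_atTop 0] with N hN
  rw [hf.integral_kernelEstimator hφ hB hK hK_supp (h_pos N) (hX N), smul_smul, mul_inv_rev,
    inv_mul_cancel_right₀ (Nat.cast_ne_zero.2 hN), Function.comp_apply]

variable [IsProbabilityMeasure P]

theorem tendstoInDistribution_sqrt_smul_kernelEstimator_sub_integral (hf : IsDensityFamily ν f)
    (hf_cont : ∀ᵐ z ∂ν, ContinuousAt (fun lam => f lam z) lam0) (hφ : AEStronglyMeasurable φ ν)
    (hB : ∀ᵐ z ∂ν, |φ z| ≤ B) (hK : ContDiff ℝ 1 K)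
    (hK_supp : Function.support K ⊆ closedCube d 1) (h_pos : ∀ N, 0 < h N)
    (h_lim : Tendsto h atTop (𝓝 0))
    (hX : ∀ N i, HasLaw (X N i) (localizedLaw ν f lam0 (h N)) P)
    (hX_indep : ∀ N, iIndepFun (X N) P) :
    TendstoInDistribution (fun (N : ℕ) ω => √((N : ℝ) * h N ^ 2) •
        (kernelEstimator K φ lam0 N (h N) (fun i => X N i ω)
          - ∫ ω', kernelEstimator K φ lam0 N (h N) (fun i => X N i ω') ∂P)) atTop
      id (fun _ => P) (multivariateGaussian 0
        (asymptoticCovariance K (densityMean ν f (fun z => φ z ^ 2) lam0))) := by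
  have hK_compact := hasCompactSupport_of_support_subset_closedCube hK_supp
  obtain ⟨A, hA⟩ := (hasCompactSupport_gradient hK_compact).exists_bound_of_continuous
    (continuous_gradient hK)
  have (N : ℕ) := hf.isProbabilityMeasure_localizedLaw lam0 (h_pos N)
  have hpsd : (asymptoticCovariance K (densityMean ν f (fun z => φ z ^ 2) lam0)).PosSemidef :=
    posSemidef_asymptoticCovariance hK hK_compact
      (integral_nonneg fun z => mul_nonneg ((hf.isProbDensity lam0).nonneg z) (sq_nonneg _))
  have h_lim' : Tendsto h atTop (𝓝[>] 0) := tendsto_nhdsWithin_iff.2 ⟨h_lim, .of_forall h_pos⟩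
  simp only [hf.sqrt_smul_kernelEstimator_sub_integral hφ hB hK hK_compact (h_pos _) (hX _)]
  exact tendstoInDistribution_inv_sqrt_smul_sum_comp_sub_integral hX hX_indep
    (fun N => (hf.integrable_kernelScore hφ hB hK hK_compact (h_pos N)).aemeasurable)
    (fun N => ae_norm_kernelScore_le hA hB f lam0 (h N)) hpsd
    fun t => (hf.tendsto_variance_inner_kernelScore hf_cont hφ hB hK hK_supp t).comp h_lim'

end IsDensityFamily

theorem tendsto_sqrt_smul_of_isBigO_pow {E : Type*} [NormedAddCommGroup E] [NormedSpace ℝ E]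
    {h : ℕ → ℝ} (h_nonneg : ∀ N, 0 ≤ h N) {b : ℕ → E} (hb : b =O[atTop] fun N => h N ^ p)
    (h_rate : Tendsto (fun N : ℕ => (N : ℝ) * h N ^ (2 * p + 2)) atTop (𝓝 0)) :
    Tendsto (fun N : ℕ => √((N : ℝ) * h N ^ 2) • b N) atTop (𝓝 0) := by
  have hscale (N : ℕ) : √((N : ℝ) * h N ^ 2) • h N ^ p = √((N : ℝ) * h N ^ (2 * p + 2)) := by
    rw [pow_add, pow_mul', mul_comm (_ ^ 2), ← mul_assoc,
      Real.sqrt_mul (by positivity) ((h N ^ p) ^ 2), Real.sqrt_sq (pow_nonneg (h_nonneg N) p),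
      smul_eq_mul]
  refine ((Asymptotics.isBigO_refl (fun N : ℕ => √((N : ℝ) * h N ^ 2)) atTop).smul
    hb).trans_tendsto ?_
  simpa only [hscale, Real.sqrt_zero] using h_rate.sqrt

theorem tendstoInDistribution_smul_sub_of_tendsto {E Ω' : Type*} [NormedAddCommGroup E]
    [NormedSpace ℝ E] [MeasurableSpace E] [BorelSpace E] [SecondCountableTopology E]
    [MeasurableSpace Ω'] {P' : Measure Ω'} [IsProbabilityMeasure P'] [IsProbabilityMeasure P]
    {c : ℕ → ℝ} {T : ℕ → Ω → E} {m : ℕ → E} {β : E} {G : Ω' → E}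
    (hT : TendstoInDistribution (fun N ω => c N • (T N ω - m N)) atTop G (fun _ => P) P')
    (hm : Tendsto (fun N => c N • (m N - β)) atTop (𝓝 0)) :
    TendstoInDistribution (fun N ω => c N • (T N ω - β)) atTop G (fun _ => P) P' := by
  have hslutsky := hT.add_of_tendstoInMeasure_const (Y := fun N _ => c N • (m N - β)) (c := 0)
    (tendstoInMeasure_of_tendsto_ae (fun _ => aestronglyMeasurable_const)
      (ae_of_all _ fun _ => hm)) (fun _ => aemeasurable_const)
  simpa [Pi.add_def, ← smul_add] using hslutsky

end Estimator

section Assumptions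

theorem exists_ae_abs_le_of_memLp_top {α : Type*} [MeasurableSpace α] {μ : Measure α} {φ : α → ℝ}
    (hφ : MemLp φ ⊤ μ) : ∃ B, ∀ᵐ z ∂μ, |φ z| ≤ B := by
  refine ⟨(eLpNormEssSup φ μ).toReal, ?_⟩
  filter_upwards [ae_le_eLpNormEssSup (f := φ) (μ := μ)] with z hz
  have hfin : eLpNormEssSup φ μ ≠ ⊤ := eLpNorm_exponent_top (f := φ) ▸ hφ.eLpNorm_ne_top
  simpa using ENNReal.toReal_mono hfin hz

theorem TimesDifferentiable.differentiable {d k : ℕ} {g : EuclideanSpace ℝ (Fin d) → ℝ}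
    (hg : TimesDifferentiable (k + 1) g) : Differentiable ℝ g := by
  have hzero := hg 0 k.succ_pos
  rwa [iteratedFDeriv_zero_eq_comp, LinearIsometryEquiv.comp_differentiable_iff] at hzero

variable {d n p : ℕ} {f : EuclideanSpace ℝ (Fin d) → EuclideanSpace ℝ (Fin n) → ℝ}
  {φ : EuclideanSpace ℝ (Fin n) → ℝ} {lam0 : EuclideanSpace ℝ (Fin d)}

theorem RegularityAssumption.dominatedOscillation_of_integrable
    (hR : RegularityAssumption f φ lam0 p) (hφ : Integrable φ) :
    DominatedOscillation (p + 1) volume f φ lam0 := by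
  obtain ⟨S, hS, hunif⟩ := hR.uniform_continuity
  have hclose := Metric.tendstoUniformlyOn_iff.1 (hunif (p + 1) le_rfl) 1 one_pos
  obtain ⟨r, hr, hball⟩ := Metric.eventually_nhds_iff_ball.1 hclose
  refine ⟨r, hr, fun z => |φ z|, hφ.abs, ae_of_all _ fun z lam hlam => ?_⟩
  by_cases hz : z ∈ tsupport φ
  · refine mul_le_of_le_one_right (abs_nonneg _) ?_
    rw [← dist_eq_norm, dist_comm]
    exact (hball lam hlam z (interior_subset (hS hz))).le
  · simp [image_eq_zero_of_notMem_tsupport hz]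

theorem LocallyDominated.dominatedOscillation {k : ℕ} (hdom : LocallyDominated k f φ lam0) :
    DominatedOscillation k volume f φ lam0 := by
  obtain ⟨r, hr, g, hg, hdom⟩ := hdom
  refine ⟨r, hr, fun z => g z + g z, hg.add hg, ?_⟩
  filter_upwards [hdom] with z hz lam hlam
  refine (mul_le_mul_of_nonneg_left (norm_sub_le _ _) (abs_nonneg _)).trans ?_
  rw [mul_add]
  exact add_le_add (hz lam hlam) (hz lam0 (Metric.mem_ball_self hr))

theorem KernelAssumption.hasVanishingMoments {K : EuclideanSpace ℝ (Fin d) → ℝ}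
    (hK : KernelAssumption K p) : HasVanishingMoments K p :=
  ⟨hK.integral_eq_one, hK.order.2.1⟩

end Assumptions

theorem theorem4p3_general {d p : ℕ} {𝓩 Ω : Type*} [MeasurableSpace 𝓩] (ν : Measure 𝓩) [SFinite ν]
    [MeasurableSpace Ω] (P : Measure Ω) [IsProbabilityMeasure P]
    (Zpar : EuclideanSpace ℝ (Fin d) → Ω → 𝓩) (f : EuclideanSpace ℝ (Fin d) → 𝓩 → ℝ)
    (hf_meas : Measurable (Function.uncurry f)) (hf_nonneg : ∀ lam z, 0 ≤ f lam z)
    (hZpar : ∀ lam, HasLaw (Zpar lam) (densityLaw ν (f lam)) P)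
    (lam0 : EuclideanSpace ℝ (Fin d))
    (hf_cont : ∀ᵐ z ∂ν, ContinuousAt (fun lam => f lam z) lam0)
    (φ : 𝓩 → ℝ) (hφ : MemLp φ ⊤ ν)
    (K : EuclideanSpace ℝ (Fin d) → ℝ) (hK : ContDiff ℝ 1 K)
    (hK_supp : Function.support K ⊆ closedCube d 1)
    (h : ℕ → ℝ) (h_pos : ∀ N, 0 < h N) (h_lim : Tendsto h atTop (𝓝 0))
    (X : (N : ℕ) → Fin N → Ω → EuclideanSpace ℝ (Fin d) × 𝓩)
    (h_law : ∀ N i, HasLaw (X N i) (localizedLaw ν f lam0 (h N)) P)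
    (h_indep : ∀ N, iIndepFun (X N) P) :
    let V : EuclideanSpace ℝ (Fin d) → ℝ := fun lam => ∫ ω, φ (Zpar lam ω) ∂P
    let β : EuclideanSpace ℝ (Fin d) := gradient V lam0
    let βhat : ℕ → Ω → EuclideanSpace ℝ (Fin d) := fun N ω =>
      kernelEstimator K φ lam0 N (h N) fun i => X N i ω
    let covu : Matrix (Fin d) (Fin d) ℝ :=
      asymptoticCovariance K (∫ ω, φ (Zpar lam0 ω) ^ 2 ∂P)
    ((∀ N, Integrable (βhat N) P) ∧
      TendstoInDistribution
        (fun (N : ℕ) ω => √((N : ℝ) * h N ^ 2) • (βhat N ω - ∫ ω', βhat N ω' ∂P)) atTop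
        id (fun _ => P) (multivariateGaussian 0 covu)) ∧
    (0 < p → HasVanishingMoments K p →
      (∀ z, TimesDifferentiable (p + 1) fun lam => f lam z) →
      DominatedOscillation (p + 1) ν f φ lam0 →
      Tendsto (fun N : ℕ => (N : ℝ) * h N ^ (2 * p + 2)) atTop (𝓝 0) →
      DifferentiableAt ℝ V lam0 ∧
      Tendsto (fun N => ∫ ω, βhat N ω ∂P) atTop (𝓝 β) ∧
      Tendsto (fun N : ℕ => √((N : ℝ) * h N ^ 2) • ((∫ ω, βhat N ω ∂P) - β)) atTop (𝓝 0) ∧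
      TendstoInDistribution
        (fun (N : ℕ) ω => √((N : ℝ) * h N ^ 2) • (βhat N ω - β)) atTop
        id (fun _ => P) (multivariateGaussian 0 covu)) := by
  intro V β βhat covu
  have hf : IsDensityFamily ν f := ⟨hf_meas, fun lam =>
    .of_hasLaw (hf_meas.comp measurable_prodMk_left) (hf_nonneg lam) (hZpar lam)⟩
  obtain ⟨B, hB⟩ := exists_ae_abs_le_of_memLp_top hφ
  have hK_compact := hasCompactSupport_of_support_subset_closedCube hK_supp
  have hV : V = densityMean ν f φ :=
    funext fun lam => hf.integral_comp_eq_densityMean (hZpar lam) hφ.1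
  have hcovu : covu = asymptoticCovariance K (densityMean ν f (fun z => φ z ^ 2) lam0) :=
    congrArg (asymptoticCovariance K) (hf.integral_comp_eq_densityMean (ψ := fun z => φ z ^ 2)
      (hZpar lam0) (hφ.1.pow 2))
  have hclt := hf.tendstoInDistribution_sqrt_smul_kernelEstimator_sub_integral hf_cont hφ.1 hB hK
    hK_supp h_pos h_lim h_law h_indep
  rw [← hcovu] at hclt
  refine ⟨⟨fun N => hf.integrable_kernelEstimator hφ.1 hB hK hK_compact (h_pos N) (h_law N), hclt⟩,
    fun hp hK_moments hF hdom h_rate => ?_⟩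
  obtain ⟨β', hβ', hbias⟩ := hf.exists_hasGradientAt_and_isBigO_bias hF hφ.1 hB hdom hp hK hK_supp
    hK_moments
  rw [← hV] at hβ'
  obtain rfl : β' = β := hβ'.gradient.symm
  have hmean := hf.isBigO_integral_kernelEstimator_sub hφ.1 hB hK hK_compact h_pos h_lim h_law hbias
  have hscaled := tendsto_sqrt_smul_of_isBigO_pow (fun N => (h_pos N).le) hmean h_rate
  refine ⟨hβ'.differentiableAt, tendsto_sub_nhds_zero_iff.1 (hmean.trans_tendsto ?_), hscaled,
    tendstoInDistribution_smul_sub_of_tendsto hclt hscaled⟩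
  simpa [hp.ne'] using h_lim.pow p

theorem theorem4p3 {d n p : ℕ}
    {Ω : Type*} [MeasurableSpace Ω] (P : Measure Ω) [IsProbabilityMeasure P]
    -- the parametric family `Z(λ)` and its densities `f(λ, ·)`
    (Zpar : EuclideanSpace ℝ (Fin d) → Ω → EuclideanSpace ℝ (Fin n))
    (f : EuclideanSpace ℝ (Fin d) → EuclideanSpace ℝ (Fin n) → ℝ)
    (hf_meas : Measurable (Function.uncurry f))
    (hf_nonneg : ∀ lam z, 0 ≤ f lam z)
    (hZpar : ∀ lam, HasLaw (Zpar lam)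
      ((volume : Measure (EuclideanSpace ℝ (Fin n))).withDensity
        (fun z => ENNReal.ofReal (f lam z))) P)
    -- the parameter of interest, the payoff and the kernel
    (lam0 : EuclideanSpace ℝ (Fin d))
    (φ : EuclideanSpace ℝ (Fin n) → ℝ) (hφ : MemLp φ ⊤ volume)
    (K : EuclideanSpace ℝ (Fin d) → ℝ)
    (hK : KernelAssumption K p)
    (hR : RegularityAssumption f φ lam0 p)
    -- the bandwidths and, for every `N`, an i.i.d. sample of size `N`
    (h : ℕ → ℝ) (h_pos : ∀ N, 0 < h N)
    (Lam : (N : ℕ) → Fin N → Ω → EuclideanSpace ℝ (Fin d))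
    (Z : (N : ℕ) → Fin N → Ω → EuclideanSpace ℝ (Fin n))
    (h_law : ∀ N i, HasLaw (fun ω => (Lam N i ω, Z N i ω))
      (randomizedLaw (uniformCubeDensity d (h N)) f lam0) P)
    (h_indep : ∀ N, iIndepFun (fun i ω => (Lam N i ω, Z N i ω)) P)
    (h_lim : Tendsto h atTop (𝓝 0))
    (h_rate : Tendsto (fun N : ℕ => (N : ℝ) * h N ^ 2) atTop atTop) :
    let V : EuclideanSpace ℝ (Fin d) → ℝ := fun lam => ∫ ω, φ (Zpar lam ω) ∂P
    let β : EuclideanSpace ℝ (Fin d) := gradient V lam0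
    let βhat : ℕ → Ω → EuclideanSpace ℝ (Fin d) := fun N ω =>
      uniformKernelEstimator K φ lam0 N (h N) (fun i => Lam N i ω) (fun i => Z N i ω)
    let covu : Matrix (Fin d) (Fin d) ℝ :=
      asymptoticCovariance K (∫ ω, φ (Zpar lam0 ω) ^ 2 ∂P)
    -- (i) asymptotic normality around the mean
    ((∀ N, Integrable (βhat N) P) ∧
      TendstoInDistribution
        (fun (N : ℕ) ω => √((N : ℝ) * h N ^ 2) • (βhat N ω - ∫ ω', βhat N ω' ∂P)) atTop
        id (fun _ => P) (multivariateGaussian 0 covu)) ∧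
    -- (ii) the bias vanishes, and asymptotic normality around `β = ∇V(lam0)`
    (Tendsto (fun N : ℕ => (N : ℝ) * h N ^ (2 * p + 2)) atTop (𝓝 0) →
      (Integrable φ ∨ LocallyDominated (p + 1) f φ lam0) →
      DifferentiableAt ℝ V lam0 ∧
      Tendsto (fun N => ∫ ω, βhat N ω ∂P) atTop (𝓝 β) ∧
      Tendsto (fun N : ℕ => √((N : ℝ) * h N ^ 2) • ((∫ ω, βhat N ω ∂P) - β)) atTop (𝓝 0) ∧
      TendstoInDistribution
        (fun (N : ℕ) ω => √((N : ℝ) * h N ^ 2) • (βhat N ω - β)) atTop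
        id (fun _ => P) (multivariateGaussian 0 covu)) := by
  obtain ⟨hclt, hunbiased⟩ := theorem4p3_general (p := p) volume P Zpar f hf_meas hf_nonneg hZpar
    lam0 (.of_forall fun z => (hR.timesDifferentiable z).differentiable.continuous.continuousAt) φ
    hφ K hK.contDiff hK.support_subset h h_pos h_lim (fun N i ω => (Lam N i ω, Z N i ω)) h_law
    h_indep
  exact ⟨hclt, fun h_rate' hdom => hunbiased hK.order.1 hK.hasVanishingMoments
    hR.timesDifferentiable
    (hdom.elim hR.dominatedOscillation_of_integrable (·.dominatedOscillation)) h_rate'⟩
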